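/- Let $d\in\mathbb N_0$, let $\Omega\subset\mathbb R^d$ be open and bounded, and let $L^2(\Omega)$ be the space of complex-valued square integrable functions with respect to Lebesgue measure. Let $H^1(\Omega)$ be the space of all $u\in L^2(\Omega)$ with weak gradient $\nabla u\in L^2(\Omega)^d$, with its usual norm, and let $C(\overline\Omega)\cap H^1(\Omega)$ be the subspace of those $u\in H^1(\Omega)$ that have a representative which is continuous on $\overline\Omega$. For a set $T\subset H^1(\Omega)$ define the operator $\Delta_T$ in $L^2(\Omega)$ by $$D(\Delta_T)=\Bigl\{u\in H^1(\Omega):\ \Delta u\in L^2(\Omega),\ \int_\Omega(\Delta u)\,\overline v+\int_\Omega\nabla u\cdot\overline{\nabla v}=0\ \text{ for all } v\in T\Bigr\},\qquad \Delta_T u=\Delta u,$$ where $\Delta u$ is the distributional Laplacian; the integral condition expresses $\partial_\nu u=0$ weakly, via Green's formula tested against $T$. The Neumann Laplacian is $\Delta^{\mathrm N}:=\Delta_{H^1(\Omega)}$. A $C_0$-semigroup $(S(t))_{t\ge0}$ on $L^2(\Omega)$ is called submarkovian if it is positive ($f\ge0$ a.e. implies $S(t)f\ge0$ a.e., for all $t>0$)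 and $L^\infty$-contractive ($\|S(t)f\|_{L^\infty(\Omega)}\le\|f\|_{L^\infty(\Omega)}$ for all $f\in L^\infty(\Omega)$, $t>0$). 1. The operator $\Delta^{\mathrm N}$ is the generator of a submarkovian $C_0$-semigroup on $L^2(\Omega)$. 2. If $C(\overline\Omega)\cap H^1(\Omega)$ is dense in $H^1(\Omega)$, then the operator $\Delta_{C(\overline\Omega)\cap H^1(\Omega)}$, for which Green's formula is tested only against $C(\overline\Omega)\cap H^1(\Omega)$, is the generator of a submarkovian $C_0$-semigroup on $L^2(\Omega)$. -/

import Mathlib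

open MeasureTheory Filter Topology TopologicalSpace
open scoped NNReal ENNReal ComplexConjugate Distributions LineDeriv

noncomputable section

namespace NeumannLap

/-! ### Semigroups and their generators -/

section Semigroup

variable {H : Type*} [NormedAddCommGroup H] [NormedSpace ℂ H]

/-- `(S(t))_{t ≥ 0}` is a `C₀`-semigroup of bounded operators on `H`. -/
structure IsC0Semigroup (S : ℝ≥0 → H →L[ℂ] H) : Prop where
  zero : S 0 = ContinuousLinearMap.id ℂ H
  add : ∀ s t : ℝ≥0, S (s + t) = (S s).comp (S t)
  strongly_continuous : ∀ f : H, Tendsto (fun t => S t f) (𝓝[>] 0) (𝓝 f)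

/-- The (unbounded) operator with graph `A` is the generator of the semigroup `S`: the pair
`(u, f)` lies in the graph exactly if the difference quotients `(S(t)u - u)/t` converge to `f` as
`t ↓ 0`. In particular the domain of the operator is the set of *all* `u` for which this limit
exists. -/
def IsGenerator (A : Set (H × H)) (S : ℝ≥0 → H →L[ℂ] H) : Prop :=
  ∀ u f : H, (u, f) ∈ A ↔
    Tendsto (fun t : ℝ≥0 => (((t : ℝ) : ℂ))⁻¹ • (S t u - u)) (𝓝[>] 0) (𝓝 f)

end Semigroup

section Submarkovian

variable {X : Type*} [MeasurableSpace X] {μ : Measure X}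

/-- `f ≥ 0` for a complex-valued `f ∈ L²`: almost everywhere `f(x)` is a nonnegative real. -/
def IsNonneg (f : Lp ℂ 2 μ) : Prop := ∀ᵐ x ∂μ, 0 ≤ (f x).re ∧ (f x).im = 0

/-- Positivity of a family of operators on complex `L²`. -/
def IsPositive (S : ℝ≥0 → Lp ℂ 2 μ →L[ℂ] Lp ℂ 2 μ) : Prop :=
  ∀ t : ℝ≥0, 0 < t → ∀ f : Lp ℂ 2 μ, IsNonneg f → IsNonneg (S t f)

/-- `L^∞`-contractivity (on a finite measure space, where `L^∞ ⊆ L²`). -/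
def IsLinftyContractive (S : ℝ≥0 → Lp ℂ 2 μ →L[ℂ] Lp ℂ 2 μ) : Prop :=
  ∀ t : ℝ≥0, 0 < t → ∀ f : Lp ℂ 2 μ, MemLp f ∞ μ → eLpNorm (S t f) ∞ μ ≤ eLpNorm f ∞ μ

/-- Submarkovian: positive and `L^∞`-contractive. -/
def IsSubmarkovian (S : ℝ≥0 → Lp ℂ 2 μ →L[ℂ] Lp ℂ 2 μ) : Prop :=
  IsPositive S ∧ IsLinftyContractive S

/-- The operator with graph `A` generates a submarkovian `C₀`-semigroup on `L²`. -/
def GeneratesSubmarkovianC0Semigroup (A : Set (Lp ℂ 2 μ × Lp ℂ 2 μ)) : Prop :=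
  ∃ S : ℝ≥0 → Lp ℂ 2 μ →L[ℂ] Lp ℂ 2 μ,
    IsC0Semigroup S ∧ IsGenerator A S ∧ IsSubmarkovian S

end Submarkovian

/-! ### Sobolev space and Neumann Laplacian on an open set -/

section Neumann

variable {d : ℕ} (Ω : Opens (EuclideanSpace ℝ (Fin d)))

/-- Complex `L²(Ω)` with Lebesgue measure. -/
abbrev L2 : Type := Lp ℂ 2 ((volume : Measure (EuclideanSpace ℝ (Fin d))).restrict Ω)

variable {Ω}

/-- The `i`-th partial derivative of a test function. -/
def pd (i : Fin d) (φ : 𝓓(Ω, ℝ)) : 𝓓(Ω, ℝ) := ∂_{EuclideanSpace.single i (1 : ℝ)} φ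

theorem pd_apply (i : Fin d) (φ : 𝓓(Ω, ℝ)) (x : EuclideanSpace ℝ (Fin d)) :
    pd i φ x = fderiv ℝ φ x (EuclideanSpace.single i 1) := by
  have h : DifferentiableAt ℝ (φ : EuclideanSpace ℝ (Fin d) → ℝ) x :=
    (φ.contDiff.differentiable (by simp)).differentiableAt
  rw [← h.lineDeriv_eq_fderiv]
  exact TestFunction.lineDerivCLM_apply_of_le (𝕜 := ℝ) (n := ⊤) (k := ⊤) (by simp)

/-- `g = ∇u` in the weak sense: `∫_Ω u ∂ᵢφ = -∫_Ω gᵢ φ` for all `i` and all test functions `φ`. -/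
def IsWeakGradient (u : L2 Ω) (g : Fin d → L2 Ω) : Prop :=
  ∀ (i : Fin d) (φ : 𝓓(Ω, ℝ)),
    ∫ x in (Ω : Set (EuclideanSpace ℝ (Fin d))), (pd i φ x) • u x =
      - ∫ x in (Ω : Set (EuclideanSpace ℝ (Fin d))), (φ x) • g i x

/-- `f = Δu` in the sense of distributions: `∫_Ω u Δφ = ∫_Ω f φ` for all test functions `φ`. -/
def IsWeakLaplacian (u f : L2 Ω) : Prop :=
  ∀ φ : 𝓓(Ω, ℝ),
    ∫ x in (Ω : Set (EuclideanSpace ℝ (Fin d))), (∑ i : Fin d, pd i (pd i φ) x) • u x =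
      ∫ x in (Ω : Set (EuclideanSpace ℝ (Fin d))), (φ x) • f x

variable (Ω)

/-- `H¹(Ω)`, each element `u` being recorded together with its weak gradient as the pair `(u, ∇u)`.
The topology inherited from `L²(Ω) × L²(Ω)^d` is that of the `H¹`-norm. -/
def H1 : Set (L2 Ω × (Fin d → L2 Ω)) := {w | IsWeakGradient w.1 w.2}

/-- `C(Ω̄) ∩ H¹(Ω)`: the elements of `H¹(Ω)` having a representative that is continuous on the
closure of `Ω`. -/
def H1Cont : Set (L2 Ω × (Fin d → L2 Ω)) :=
  {w | w ∈ H1 Ω ∧ ∃ v : EuclideanSpace ℝ (Fin d) → ℂ,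
    ContinuousOn v (closure (Ω : Set (EuclideanSpace ℝ (Fin d)))) ∧
    ∀ᵐ x ∂(volume.restrict (Ω : Set (EuclideanSpace ℝ (Fin d)))), w.1 x = v x}

variable {Ω}

/-- `∂_ν u = 0` in the sense of Green's formula, where `g = ∇u`, `f = Δu`:
`∫_Ω (Δu) v̄ + ∫_Ω ∇u · conj ∇v = 0` for all `v` in the class `T ⊆ H¹(Ω)` of test functions
(the boundary integral `∫_Γ h v̄` vanishes for `h = 0`). -/
def NormalDerivEqZero (T : Set (L2 Ω × (Fin d → L2 Ω))) (g : Fin d → L2 Ω) (f : L2 Ω) : Prop :=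
  ∀ w ∈ T,
    (∫ x in (Ω : Set (EuclideanSpace ℝ (Fin d))), f x * conj (w.1 x)) +
      (∫ x in (Ω : Set (EuclideanSpace ℝ (Fin d))), ∑ i : Fin d, g i x * conj (w.2 i x)) = 0

/-- Graph of the realisation `u ↦ Δu` in `L²(Ω)` with domain
`{u ∈ H¹(Ω) : Δu ∈ L²(Ω), ∂_ν u = 0}`, the normal derivative being tested against `T`. -/
def neumannGraph (T : Set (L2 Ω × (Fin d → L2 Ω))) : Set (L2 Ω × L2 Ω) :=
  {p | ∃ g : Fin d → L2 Ω,
    IsWeakGradient p.1 g ∧ IsWeakLaplacian p.1 p.2 ∧ NormalDerivEqZero T g p.2}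

variable (Ω)

/-- The Neumann Laplacian (its graph): Green's formula is tested against all of `H¹(Ω)`. -/
def neumannLaplacian : Set (L2 Ω × L2 Ω) := neumannGraph (H1 Ω)

/-- The variant (its graph) in which Green's formula is tested only against `C(Ω̄) ∩ H¹(Ω)`. -/
def neumannLaplacianCont : Set (L2 Ω × L2 Ω) := neumannGraph (H1Cont Ω)

end Neumann

end NeumannLap

end

/-! Let J be the inclusion of H¹(Ω) into L²(Ω). The Riesz theorem gives (1 - Δᴺ)⁻¹ = J J* =: R, so R
is nonnegative and contractive, and it is injective because J has dense range. Since (u, f) is in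
the graph of Δᴺ exactly if R(u - f) = u (`mem_neumannLaplacian_iff`), everything about Δᴺ = 1 - R⁻¹
can be read off from the bounded operator R. The semigroup is the continuous functional calculus of
R at exp(t(1 - 1/x)). This symbol tends to 0 at x = 0, and scalar inequalities for it, weighted with
one or two factors x, yield strong continuity and the generator (`isGenerator_cfcSemigroup`).

Positivity and L^∞-contractivity both follow once S(t) preserves the functions with values in a
half-plane Re(cz) ≤ M, M ≥ 0 (`isSubmarkovian_of_halfPlaneSet`). These sets are closed, so by
Euler's formula S(t) = lim (1 - (t/n)Δᴺ)⁻ⁿ it is enough that the resolvents preserve them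
(`cfcSemigroup_mem_of_isClosed`). By complex linearity c = 1 suffices, and there Stampacchia's
argument applies (`re_le_of_re_sub_smul_le`): Green's formula is tested against G(Re u) with G
increasing and zero up to M. That G(Re u) lies in H¹(Ω) is a chain rule, proved by difference
quotients (`HasWeakDirDeriv.comp`).

For the second claim, Green's formula is continuous in the test function, so density of the smaller
class makes the two operators equal (`neumannLaplacianCont_eq`). -/

namespace NeumannLap

/-! ### Scalar inequalities for the semigroup and resolvent symbols -/

section ScalarEstimates

open Real

/-- The function `x ↦ exp (t * (1 - 1 / x))`, extended by `0` to `x ≤ 0`. -/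
noncomputable def heatSymbol (t x : ℝ) : ℝ := exp t * expNegInvGlue (x / t)

/-- Continuity at `0` matters: `0` belongs to the spectrum of `R` whenever `R⁻¹` is unbounded. -/
theorem continuous_heatSymbol (t : ℝ) : Continuous (heatSymbol t) := by
  have : Continuous expNegInvGlue := expNegInvGlue.contDiff (n := 0).continuous
  unfold heatSymbol
  fun_prop

theorem heatSymbol_zero {t : ℝ} : heatSymbol t 0 = 0 := by
  simp [heatSymbol, expNegInvGlue.zero]

theorem heatSymbol_of_pos {t x : ℝ} (ht : 0 < t) (hx : 0 < x) :
    heatSymbol t x = exp (-(t * (1 / x - 1))) := by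
  have : ¬ x / t ≤ 0 := not_le.2 (by positivity)
  rw [heatSymbol, expNegInvGlue, if_neg this, ← exp_add]
  congr 1
  field_simp
  ring

theorem heatSymbol_add {s t x : ℝ} (hs : 0 < s) (ht : 0 < t) (hx : 0 ≤ x) :
    heatSymbol (s + t) x = heatSymbol s x * heatSymbol t x := by
  rcases hx.eq_or_lt with rfl | hx
  · simp [heatSymbol_zero]
  · rw [heatSymbol_of_pos hs hx, heatSymbol_of_pos ht hx, heatSymbol_of_pos (add_pos hs ht) hx,
      ← exp_add]
    congr 1
    ring

theorem heatSymbol_mem_Icc {t x : ℝ} (ht : 0 < t) (hx : x ∈ Set.Icc (0 : ℝ) 1) :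
    heatSymbol t x ∈ Set.Icc (0 : ℝ) 1 := by
  rcases hx.1.eq_or_lt with rfl | hx0
  · simp [heatSymbol_zero]
  · rw [heatSymbol_of_pos ht hx0]
    refine ⟨(exp_pos _).le, exp_le_one_iff.2 ?_⟩
    have : 1 ≤ 1 / x := by rw [le_div_iff₀ hx0]; linarith [hx.2]
    have : 0 ≤ t * (1 / x - 1) := mul_nonneg ht.le (by linarith)
    linarith

/-- The factor `x` absorbs the singularity: with `a = t (1/x - 1)`, one has `1 - exp (-a) ≤ a` and
`a x = t (1 - x) ≤ t`. -/
theorem abs_heatSymbol_sub_one_mul_le {t x : ℝ} (ht : 0 < t) (hx : x ∈ Set.Icc (0 : ℝ) 1) :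
    |(heatSymbol t x - 1) * x| ≤ t := by
  rcases hx.1.eq_or_lt with rfl | hx0
  · simp [ht.le]
  · have h1 := (heatSymbol_mem_Icc ht hx).2
    have h2 := add_one_le_exp (-(t * (1 / x - 1)))
    rw [← heatSymbol_of_pos ht hx0] at h2
    have h3 : (1 / x - 1) * x = 1 - x := by field_simp
    rw [abs_le]
    constructor
    · have := mul_le_mul_of_nonneg_right h2 hx0.le
      nlinarith [mul_nonneg ht.le hx0.le]
    · nlinarith [hx.2]

/-- Second-order version: the Taylor remainder of `exp (-a)` is at most `a²`, and two factors `x`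
turn this into `(a x)² ≤ t²`. -/
theorem abs_heatSymbol_sub_linear_mul_le {t x : ℝ} (ht : 0 < t) (hx : x ∈ Set.Icc (0 : ℝ) 1) :
    |(heatSymbol t x - 1) * x * x - t * (x - 1) * x| ≤ t ^ 2 := by
  rcases hx.1.eq_or_lt with rfl | hx0
  · simp; positivity
  · have h1x : 1 ≤ 1 / x := by rw [le_div_iff₀ hx0]; linarith [hx.2]
    set a := t * (1 / x - 1) with ha
    have ha0 : 0 ≤ a := mul_nonneg ht.le (by linarith)
    have hax : a * x = t * (1 - x) := by rw [ha]; field_simp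
    have h2 : |heatSymbol t x - 1 + a| ≤ a ^ 2 := by
      rw [heatSymbol_of_pos ht hx0, ← ha, abs_le]
      have h3 := add_one_le_exp (-a)
      refine ⟨by nlinarith, ?_⟩
      have h4 : exp (-a) ≤ 1 / (1 + a) := by
        rw [exp_neg, ← one_div]
        exact one_div_le_one_div_of_le (by linarith) (by linarith [add_one_le_exp a])
      -- `(1 + a)(1 - a + a²) = 1 + a³`.
      have h5 : 1 / (1 + a) ≤ 1 - a + a ^ 2 := by
        rw [div_le_iff₀ (by linarith)]
        nlinarith [pow_nonneg ha0 3]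
      linarith
    have : (heatSymbol t x - 1) * x * x - t * (x - 1) * x = (heatSymbol t x - 1 + a) * x ^ 2 := by
      linear_combination (-x) * hax
    rw [this, abs_mul, abs_of_nonneg (sq_nonneg x)]
    calc _ ≤ a ^ 2 * x ^ 2 := by gcongr
      _ = t ^ 2 * (1 - x) ^ 2 := by linear_combination (a * x + t * (1 - x)) * hax
      _ ≤ t ^ 2 * 1 := by
        gcongr
        nlinarith [hx.2]
      _ = t ^ 2 := mul_one _

/-- The symbol of the resolvent `(1 - h A)⁻¹`, in terms of the spectral variable `x` of
`(1 - A)⁻¹`. -/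
noncomputable def resolventSymbol (h x : ℝ) : ℝ := x / (x + h * (1 - x))

theorem resolventSymbol_denom_pos {h x : ℝ} (hh : 0 < h) (hx : x ∈ Set.Icc (0 : ℝ) 1) :
    0 < x + h * (1 - x) := by
  rcases hx.1.eq_or_lt with rfl | hx0
  · simpa
  · have := mul_nonneg hh.le (sub_nonneg.2 hx.2)
    linarith

theorem abs_pow_sub_pow_le_of_abs_le_one {a b : ℝ} (ha : |a| ≤ 1) (hb : |b| ≤ 1) (n : ℕ) :
    |a ^ n - b ^ n| ≤ n * |a - b| := by
  induction n with
  | zero => simp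
  | succ n ih =>
    have : a ^ (n + 1) - b ^ (n + 1) = a ^ n * (a - b) + (a ^ n - b ^ n) * b := by ring
    rw [this]
    calc _ ≤ |a ^ n * (a - b)| + |(a ^ n - b ^ n) * b| := abs_add_le _ _
      _ = |a| ^ n * |a - b| + |a ^ n - b ^ n| * |b| := by rw [abs_mul, abs_mul, abs_pow]
      _ ≤ 1 * |a - b| + n * |a - b| * 1 := by
        gcongr
        exact pow_le_one₀ (abs_nonneg a) ha
      _ = _ := by push_cast; ring

/-- Euler's exponential formula on the level of symbols. -/
theorem abs_resolventSymbol_pow_sub_heatSymbol_mul_le {t x : ℝ} (ht : 0 < t)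
    (hx : x ∈ Set.Icc (0 : ℝ) 1) {n : ℕ} (hn : 0 < n) :
    |(resolventSymbol (t / n) x ^ n - heatSymbol t x) * x * x| ≤ t ^ 2 / n := by
  have hn' : (0 : ℝ) < n := by exact_mod_cast hn
  rcases hx.1.eq_or_lt with rfl | hx0
  · simp; positivity
  · have h1x : 1 ≤ 1 / x := by rw [le_div_iff₀ hx0]; linarith [hx.2]
    set b := t / n * (1 / x - 1) with hb
    have hb0 : 0 ≤ b := mul_nonneg (by positivity) (by linarith)
    have hbx : n * b * x = t * (1 - x) := by rw [hb]; field_simp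
    have h1 : resolventSymbol (t / n) x = 1 / (1 + b) := by
      have h2 := resolventSymbol_denom_pos (h := t / n) (by positivity) hx
      rw [resolventSymbol, div_eq_div_iff h2.ne' (by positivity), hb]
      field_simp
    have h2 : heatSymbol t x = exp (-b) ^ n := by
      rw [heatSymbol_of_pos ht hx0, ← exp_nat_mul, hb]
      congr 1
      field_simp
    have h3 : |1 / (1 + b) - exp (-b)| ≤ b ^ 2 := by
      have h4 : exp (-b) ≤ 1 / (1 + b) := by
        rw [exp_neg, ← one_div]
        exact one_div_le_one_div_of_le (by linarith) (by linarith [add_one_le_exp b])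
      have h5 : 1 / (1 + b) ≤ 1 - b + b ^ 2 := by
        rw [div_le_iff₀ (by linarith)]
        nlinarith [pow_nonneg hb0 3]
      rw [abs_of_nonneg (by linarith)]
      linarith [add_one_le_exp (-b)]
    have h6 : |1 / (1 + b) ^ 1| ≤ 1 := by
      rw [pow_one, abs_of_nonneg (by positivity), div_le_one (by positivity)]
      linarith
    rw [pow_one] at h6
    have h7 : |exp (-b)| ≤ 1 := by
      rw [abs_of_pos (exp_pos _), exp_le_one_iff]
      linarith
    rw [mul_assoc, abs_mul, abs_of_nonneg (mul_nonneg hx0.le hx0.le), h1, h2]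
    -- Each of the `n` factors contributes an error of at most `b²`; since `n b x = t (1 - x)`, the
    -- sum weighted by `x²` is of order `1/n`.
    calc _ ≤ (n * b ^ 2) * (x * x) := by
          gcongr
          exact (abs_pow_sub_pow_le_of_abs_le_one h6 h7 n).trans (by gcongr)
      _ = (n * b * x) ^ 2 / n := by field_simp
      _ = t ^ 2 * (1 - x) ^ 2 / n := by rw [hbx, mul_pow]
      _ ≤ t ^ 2 * 1 / n := by
        gcongr
        nlinarith [hx.2]
      _ = t ^ 2 / n := by rw [mul_one]

end ScalarEstimates

/-- An ε/2 argument for uniformly bounded operators. It serves strong continuity, the generator,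
Euler's formula and the weak limit of difference quotients. -/
theorem tendsto_apply_of_denseRange {𝕜 E F ι : Type*} [NontriviallyNormedField 𝕜]
    [NormedAddCommGroup E] [NormedSpace 𝕜 E] [NormedAddCommGroup F] [NormedSpace 𝕜 F]
    {α : Type*} {l : Filter ι} {T : ι → E →L[𝕜] F} {T₀ : E →L[𝕜] F} {C : ℝ}
    (hT : ∀ᶠ i in l, ‖T i‖ ≤ C) {r : α → E} (hr : DenseRange r)
    (h : ∀ v, Tendsto (fun i => T i (r v)) l (𝓝 (T₀ (r v)))) (u : E) :
    Tendsto (fun i => T i u) l (𝓝 (T₀ u)) := by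
  rw [Metric.tendsto_nhds]
  intro ε hε
  -- The summand `1` only keeps `K` positive.
  set K := |C| + ‖T₀‖ + 1 with hK
  have hKpos : 0 < K := by positivity
  obtain ⟨v, hv⟩ := hr.exists_dist_lt u (show 0 < ε / (2 * K) by positivity)
  filter_upwards [hT, Metric.tendsto_nhds.1 (h v) (ε / 2) (by positivity)] with i hi hiv
  rw [dist_eq_norm] at hv hiv ⊢
  have : T i u - T₀ u = T i (u - r v) + (T i (r v) - T₀ (r v)) - T₀ (u - r v) := by
    simp only [map_sub]; abel
  rw [this]
  have h1 : ‖T i (u - r v)‖ ≤ |C| * ‖u - r v‖ :=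
    (T i).le_of_opNorm_le (hi.trans (le_abs_self C)) _
  have h2 : ‖T₀ (u - r v)‖ ≤ ‖T₀‖ * ‖u - r v‖ := T₀.le_opNorm _
  have h3 : K * ‖u - r v‖ < ε / 2 := by
    have := mul_lt_mul_of_pos_left hv hKpos
    calc _ < _ := this
      _ = ε / 2 := by field_simp
  have h4 := norm_nonneg (u - r v)
  calc _ ≤ ‖T i (u - r v)‖ + ‖T i (r v) - T₀ (r v)‖ + ‖T₀ (u - r v)‖ :=
        (norm_sub_le _ _).trans (by gcongr; exact norm_add_le _ _)
    _ < ε := by nlinarith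

/-! ### The semigroup generated by `1 - R⁻¹` and Euler's formula -/

section Semigroup

variable {H : Type*} [NormedAddCommGroup H] [InnerProductSpace ℂ H] [CompleteSpace H]

open Classical in
/-- The semigroup generated by `1 - R⁻¹`, defined by functional calculus. -/
noncomputable def cfcSemigroup (R : H →L[ℂ] H) (t : ℝ≥0) : H →L[ℂ] H :=
  -- At `t = 0` the convention `x / 0 = 0` makes the symbol vanish instead of being `1`.
  if t = 0 then 1 else cfc (heatSymbol t) R

theorem cfcSemigroup_of_pos (R : H →L[ℂ] H) {t : ℝ≥0} (ht : 0 < t) :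
    cfcSemigroup R t = cfc (heatSymbol t) R := if_neg ht.ne'

variable {R : H →L[ℂ] H}

theorem spectrum_subset_Icc (hR₀ : 0 ≤ R) (hR₁ : ‖R‖ ≤ 1) : spectrum ℝ R ⊆ Set.Icc 0 1 := by
  intro x hx
  refine ⟨spectrum_nonneg_of_nonneg hR₀ hx, ?_⟩
  have := spectrum.norm_le_norm_mul_of_mem hx
  -- Only `≤`, since `H` may be trivial, as for empty `Ω`.
  have h1 : ‖(1 : H →L[ℂ] H)‖ ≤ 1 := ContinuousLinearMap.norm_id_le
  have h2 : ‖R‖ * ‖(1 : H →L[ℂ] H)‖ ≤ 1 := mul_le_one₀ hR₁ (norm_nonneg _) h1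
  exact (le_abs_self x).trans (this.trans h2)

theorem norm_cfcSemigroup_le (hR₀ : 0 ≤ R) (hR₁ : ‖R‖ ≤ 1) (t : ℝ≥0) :
    ‖cfcSemigroup R t‖ ≤ 1 := by
  rcases eq_zero_or_pos t with rfl | ht
  · rw [cfcSemigroup, if_pos rfl]
    exact ContinuousLinearMap.norm_id_le
  · rw [cfcSemigroup_of_pos R ht]
    refine norm_cfc_le zero_le_one fun x hx => ?_
    have := heatSymbol_mem_Icc (t := t) ht (spectrum_subset_Icc hR₀ hR₁ hx)
    rw [Real.norm_of_nonneg this.1]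
    exact this.2

theorem cfcSemigroup_add (hR₀ : 0 ≤ R) (hR₁ : ‖R‖ ≤ 1) (s t : ℝ≥0) :
    cfcSemigroup R (s + t) = cfcSemigroup R s * cfcSemigroup R t := by
  rcases eq_zero_or_pos s with rfl | hs
  · simp [cfcSemigroup]
  rcases eq_zero_or_pos t with rfl | ht
  · simp [cfcSemigroup]
  rw [cfcSemigroup_of_pos R hs, cfcSemigroup_of_pos R ht,
    cfcSemigroup_of_pos R (add_pos hs ht), ← cfc_mul _ _ R
      (continuous_heatSymbol _).continuousOn (continuous_heatSymbol _).continuousOn]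
  refine cfc_congr fun x hx => ?_
  exact heatSymbol_add hs ht (spectrum_subset_Icc hR₀ hR₁ hx).1

theorem norm_cfcSemigroup_sub_one_mul_le (hR₀ : 0 ≤ R) (hR₁ : ‖R‖ ≤ 1) {t : ℝ≥0} (ht : 0 < t) :
    ‖(cfcSemigroup R t - 1) * R‖ ≤ t := by
  have hsa : IsSelfAdjoint R := .of_nonneg hR₀
  have hc := (continuous_heatSymbol t).continuousOn (s := spectrum ℝ R)
  have : (cfcSemigroup R t - 1) * R = cfc (fun x => (heatSymbol t x - 1) * x) R := by
    rw [cfc_mul (fun x => heatSymbol t x - 1) (fun x => x) R (by fun_prop) (by fun_prop),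
      cfc_sub (heatSymbol t) (fun _ => 1) R hc (by fun_prop), cfc_const_one ℝ R, cfc_id' ℝ R,
      cfcSemigroup_of_pos R ht]
  rw [this]
  refine norm_cfc_le t.2 fun x hx => ?_
  exact abs_heatSymbol_sub_one_mul_le ht (spectrum_subset_Icc hR₀ hR₁ hx)

theorem norm_cfcSemigroup_sub_linear_mul_le (hR₀ : 0 ≤ R) (hR₁ : ‖R‖ ≤ 1) {t : ℝ≥0}
    (ht : 0 < t) :
    ‖(cfcSemigroup R t - 1) * R * R - (t : ℝ) • ((R - 1) * R)‖ ≤ (t : ℝ) ^ 2 := by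
  have hsa : IsSelfAdjoint R := .of_nonneg hR₀
  have hc := (continuous_heatSymbol t).continuousOn (s := spectrum ℝ R)
  have : (cfcSemigroup R t - 1) * R * R - (t : ℝ) • ((R - 1) * R) =
      cfc (fun x => (heatSymbol t x - 1) * x * x - t * (x - 1) * x) R := by
    simp only [mul_assoc (t : ℝ)]
    rw [cfc_sub (fun x => (heatSymbol t x - 1) * x * x) (fun x => (t : ℝ) * ((x - 1) * x)) R
        (by fun_prop) (by fun_prop),
      cfc_mul (fun x => (heatSymbol t x - 1) * x) (fun x => x) R (by fun_prop) (by fun_prop),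
      cfc_mul (fun x => heatSymbol t x - 1) (fun x => x) R (by fun_prop) (by fun_prop),
      cfc_sub (heatSymbol t) (fun _ => 1) R hc (by fun_prop),
      cfc_const_mul (t : ℝ) (fun x => (x - 1) * x) R (by fun_prop),
      cfc_mul (fun x => x - 1) (fun x => x) R (by fun_prop) (by fun_prop),
      cfc_sub (fun x => x) (fun _ => 1) R (by fun_prop) (by fun_prop),
      cfc_const_one ℝ R, cfc_id' ℝ R, cfcSemigroup_of_pos R ht]
  rw [this]
  refine norm_cfc_le (sq_nonneg _) fun x hx => ?_
  exact abs_heatSymbol_sub_linear_mul_le ht (spectrum_subset_Icc hR₀ hR₁ hx)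

/-- The orthogonal complement of the range is the kernel of `R* = R`. -/
theorem denseRange_of_injective_of_isSelfAdjoint (hR : IsSelfAdjoint R)
    (hinj : Function.Injective R) : DenseRange R := by
  have h : R.rangeᗮ = ⊥ := by
    rw [ContinuousLinearMap.orthogonal_range, ← ContinuousLinearMap.star_eq_adjoint, hR.star_eq]
    exact LinearMap.ker_eq_bot.2 hinj
  have h2 := Submodule.topologicalClosure_eq_top_iff.2 h
  have := (Submodule.dense_iff_topologicalClosure_eq_top).2 h2
  exact this

theorem tendsto_cfcSemigroup (hR₀ : 0 ≤ R) (hR₁ : ‖R‖ ≤ 1) (hinj : Function.Injective R) (u : H) :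
    Tendsto (fun t => cfcSemigroup R t u) (𝓝[>] 0) (𝓝 u) := by
  refine tendsto_apply_of_denseRange (T₀ := 1)
    (Eventually.of_forall fun t => norm_cfcSemigroup_le hR₀ hR₁ t)
    (denseRange_of_injective_of_isSelfAdjoint (.of_nonneg hR₀) hinj) (fun v => ?_) u
  rw [tendsto_iff_norm_sub_tendsto_zero]
  have hlim : Tendsto (fun t : ℝ≥0 => (t : ℝ) * ‖v‖) (𝓝[>] 0) (𝓝 0) := by
    have : Continuous fun t : ℝ≥0 => (t : ℝ) * ‖v‖ := by fun_prop
    simpa using (this.tendsto 0).mono_left nhdsWithin_le_nhds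
  refine squeeze_zero' (Eventually.of_forall fun _ => norm_nonneg _) ?_ hlim
  filter_upwards [self_mem_nhdsWithin] with t ht
  exact ((cfcSemigroup R t - 1) * R).le_of_opNorm_le
    (norm_cfcSemigroup_sub_one_mul_le hR₀ hR₁ ht) v

/-- The operators `t⁻¹ (S(t) - 1) R` are contractions by the first-order estimate. On the dense
range of `R` a second factor `R` is available, and the second-order estimate gives convergence at
rate `t`. -/
theorem tendsto_cfcSemigroup_slope (hR₀ : 0 ≤ R) (hR₁ : ‖R‖ ≤ 1) (hinj : Function.Injective R)
    (v : H) :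
    Tendsto (fun t : ℝ≥0 => (((t : ℝ) : ℂ))⁻¹ • (cfcSemigroup R t (R v) - R v)) (𝓝[>] 0)
      (𝓝 (R v - v)) := by
  refine tendsto_apply_of_denseRange (C := 1)
    (T := fun t : ℝ≥0 => (((t : ℝ) : ℂ))⁻¹ • ((cfcSemigroup R t - 1) * R)) (T₀ := R - 1)
    ?_ (denseRange_of_injective_of_isSelfAdjoint (.of_nonneg hR₀) hinj) (fun v => ?_) v
  · filter_upwards [self_mem_nhdsWithin] with t ht
    have ht' : (0 : ℝ) < t := ht
    rw [norm_smul, norm_inv, Complex.norm_real, Real.norm_of_nonneg ht'.le, inv_mul_le_iff₀ ht',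
      mul_one]
    exact norm_cfcSemigroup_sub_one_mul_le hR₀ hR₁ ht
  · rw [tendsto_iff_norm_sub_tendsto_zero]
    have hlim : Tendsto (fun t : ℝ≥0 => (t : ℝ) * ‖v‖) (𝓝[>] 0) (𝓝 0) := by
      have : Continuous fun t : ℝ≥0 => (t : ℝ) * ‖v‖ := by fun_prop
      simpa using (this.tendsto 0).mono_left nhdsWithin_le_nhds
    refine squeeze_zero' (Eventually.of_forall fun _ => norm_nonneg _) ?_ hlim
    filter_upwards [self_mem_nhdsWithin] with t ht
    have ht' : (0 : ℝ) < t := ht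
    have h1 := ((cfcSemigroup R t - 1) * R * R - (t : ℝ) • ((R - 1) * R)).le_of_opNorm_le
      (norm_cfcSemigroup_sub_linear_mul_le hR₀ hR₁ ht) v
    have h2 : ((((t : ℝ) : ℂ))⁻¹ • ((cfcSemigroup R t - 1) * R)) (R v) - (R - 1) (R v) =
        (((t : ℝ) : ℂ))⁻¹ • ((cfcSemigroup R t - 1) * R * R - (t : ℝ) • ((R - 1) * R)) v := by
      have h3 : ((t : ℝ) : ℂ) ≠ 0 := by exact_mod_cast ht'.ne'
      change _ = (((t : ℝ) : ℂ))⁻¹ • (((cfcSemigroup R t - 1) * R * R) v -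
        ((t : ℝ) : ℂ) • ((R - 1) * R) v)
      rw [smul_sub, smul_smul, inv_mul_cancel₀ h3, one_smul]
      rfl
    rw [h2, norm_smul, norm_inv, Complex.norm_real, Real.norm_of_nonneg ht'.le,
      inv_mul_le_iff₀ ht']
    linarith

theorem isC0Semigroup_cfcSemigroup (hR₀ : 0 ≤ R) (hR₁ : ‖R‖ ≤ 1) (hinj : Function.Injective R) :
    IsC0Semigroup (cfcSemigroup R) where
  zero := if_pos rfl
  add s t := cfcSemigroup_add hR₀ hR₁ s t
  strongly_continuous := tendsto_cfcSemigroup hR₀ hR₁ hinj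

theorem cfcSemigroup_commute (hR : IsSelfAdjoint R) (t : ℝ≥0) : Commute (cfcSemigroup R t) R := by
  unfold cfcSemigroup
  split_ifs
  · exact Commute.one_left R
  · simpa only [cfc_id ℝ R] using cfc_commute_cfc (heatSymbol t) id R

theorem isGenerator_cfcSemigroup (hR₀ : 0 ≤ R) (hR₁ : ‖R‖ ≤ 1) (hinj : Function.Injective R)
    {A : Set (H × H)} (hA : ∀ u f, (u, f) ∈ A ↔ R (u - f) = u) :
    IsGenerator A (cfcSemigroup R) := by
  intro u f
  rw [hA]
  constructor
  · intro h
    have := tendsto_cfcSemigroup_slope hR₀ hR₁ hinj (u - f)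
    rwa [h, sub_sub_cancel] at this
  · intro h
    -- For the converse, `R` is applied to the difference quotients. It commutes with the semigroup,
    -- so they become the quotients at `R u`, whose limit `R u - u` is known.
    have h1 := (R.continuous.tendsto f).comp h
    have h2 := tendsto_cfcSemigroup_slope hR₀ hR₁ hinj u
    have h3 : R f = R u - u := by
      refine tendsto_nhds_unique h1 (h2.congr fun t => ?_)
      have := DFunLike.congr_fun (cfcSemigroup_commute (.of_nonneg hR₀) t).eq u
      simp only [mul_apply_eq_comp] at this
      simp [this]
    rw [map_sub, h3, sub_sub_cancel]

/-- With `A = 1 - R⁻¹` and `u = R w` one has `w - u = -A u`, so the second equation says `(1 - h A)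
u = v` without naming `A`. The witness is `w = K v` with `K = (R + h (1 - R))⁻¹`. -/
theorem cfc_resolventSymbol_apply (hR₀ : 0 ≤ R) (hR₁ : ‖R‖ ≤ 1) {h : ℝ} (hh : 0 < h) (v : H) :
    ∃ w, cfc (resolventSymbol h) R v = R w ∧ R w + (h : ℂ) • (w - R w) = v := by
  have hsa : IsSelfAdjoint R := .of_nonneg hR₀
  have hne : ∀ x ∈ spectrum ℝ R, x + h * (1 - x) ≠ 0 := fun x hx =>
    (resolventSymbol_denom_pos hh (spectrum_subset_Icc hR₀ hR₁ hx)).ne'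
  have hc : ContinuousOn (fun x : ℝ => (x + h * (1 - x))⁻¹) (spectrum ℝ R) :=
    ContinuousOn.inv₀ (by fun_prop) hne
  set K := cfc (fun x : ℝ => (x + h * (1 - x))⁻¹) R with hK
  have h1 : cfc (resolventSymbol h) R = R * K := by
    have : R * K = cfc (fun x : ℝ => x) R * K := by rw [cfc_id' ℝ R]
    rw [this, hK, ← cfc_mul (fun x : ℝ => x) _ R (by fun_prop) hc]
    rfl
  have h2 : (R + h • (1 - R)) * K = 1 := by
    have : R + h • (1 - R) = cfc (fun x : ℝ => x + h * (1 - x)) R := by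
      rw [cfc_add R (fun x : ℝ => x) (fun x => h * (1 - x)) (by fun_prop) (by fun_prop),
        cfc_const_mul h (fun x => 1 - x) R (by fun_prop),
        cfc_sub (fun _ => 1) (fun x => x) R (by fun_prop) (by fun_prop),
        cfc_const_one ℝ R, cfc_id' ℝ R]
    rw [this, hK, ← cfc_mul _ _ R (by fun_prop) hc, ← cfc_const_one ℝ R]
    exact cfc_congr fun x hx => mul_inv_cancel₀ (hne x hx)
  refine ⟨K v, by rw [h1]; rfl, ?_⟩
  have := DFunLike.congr_fun h2 v
  simpa using this

theorem norm_cfc_resolventSymbol_pow_sub_le (hR₀ : 0 ≤ R) (hR₁ : ‖R‖ ≤ 1) {t : ℝ≥0} (ht : 0 < t)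
    {n : ℕ} (hn : 0 < n) :
    ‖(cfc (resolventSymbol (t / n)) R ^ n - cfcSemigroup R t) * R * R‖ ≤ (t : ℝ) ^ 2 / n := by
  have hsa : IsSelfAdjoint R := .of_nonneg hR₀
  have hc := (continuous_heatSymbol t).continuousOn (s := spectrum ℝ R)
  have ht' : (0 : ℝ) < t := ht
  have hn' : (0 : ℝ) < n := by exact_mod_cast hn
  have hc' : ContinuousOn (resolventSymbol (t / n)) (spectrum ℝ R) :=
    ContinuousOn.div (by fun_prop) (by fun_prop) fun x hx =>
      (resolventSymbol_denom_pos (by positivity) (spectrum_subset_Icc hR₀ hR₁ hx)).ne'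
  have : (cfc (resolventSymbol (t / n)) R ^ n - cfcSemigroup R t) * R * R =
      cfc (fun x => (resolventSymbol (t / n) x ^ n - heatSymbol t x) * x * x) R := by
    rw [cfc_mul (fun x => (resolventSymbol (t / n) x ^ n - heatSymbol t x) * x) (fun x => x) R
        (by fun_prop) (by fun_prop),
      cfc_mul (fun x => resolventSymbol (t / n) x ^ n - heatSymbol t x) (fun x => x) R
        (by fun_prop) (by fun_prop),
      cfc_sub (fun x => resolventSymbol (t / n) x ^ n) (heatSymbol t) R (by fun_prop) hc,
      cfc_pow (resolventSymbol (t / n)) n R hc', cfc_id' ℝ R, cfcSemigroup_of_pos R ht]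
  rw [this]
  refine norm_cfc_le (by positivity) fun x hx => ?_
  exact abs_resolventSymbol_pow_sub_heatSymbol_mul_le ht' (spectrum_subset_Icc hR₀ hR₁ hx) hn

theorem norm_cfc_resolventSymbol_le (hR₀ : 0 ≤ R) (hR₁ : ‖R‖ ≤ 1) {h : ℝ} (hh : 0 < h) :
    ‖cfc (resolventSymbol h) R‖ ≤ 1 := by
  refine norm_cfc_le zero_le_one fun x hx => ?_
  have hx' := spectrum_subset_Icc hR₀ hR₁ hx
  have := resolventSymbol_denom_pos hh hx'
  rw [resolventSymbol, Real.norm_of_nonneg (div_nonneg hx'.1 this.le), div_le_one this]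
  have := mul_nonneg hh.le (sub_nonneg.2 hx'.2)
  linarith

/-- A closed set that is invariant under the resolvents is invariant under the semigroup. -/
theorem cfcSemigroup_mem_of_isClosed (hR₀ : 0 ≤ R) (hR₁ : ‖R‖ ≤ 1) (hinj : Function.Injective R)
    {C : Set H} (hC : IsClosed C)
    (hinv : ∀ h : ℝ, 0 < h → ∀ w : H, R w + (h : ℂ) • (w - R w) ∈ C → R w ∈ C)
    {t : ℝ≥0} (ht : 0 < t) {v : H} (hv : v ∈ C) : cfcSemigroup R t v ∈ C := by
  have ht' : (0 : ℝ) < t := ht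
  set J : ℕ → H →L[ℂ] H := fun n => cfc (resolventSymbol (t / n)) R with hJ
  have hpow : ∀ n : ℕ, 0 < n → ∀ k : ℕ, (J n ^ k) v ∈ C := by
    intro n hn k
    have hn' : (0 : ℝ) < n := by exact_mod_cast hn
    induction k with
    | zero => simpa using hv
    | succ k ih =>
      obtain ⟨w, hw, hw'⟩ := cfc_resolventSymbol_apply hR₀ hR₁ (h := t / n) (by positivity)
        ((J n ^ k) v)
      rw [pow_succ', mul_apply_eq_comp, hw]
      exact hinv _ (by positivity) w (hw' ▸ ih)
  have hd := denseRange_of_injective_of_isSelfAdjoint (.of_nonneg hR₀) hinj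
  -- Euler's formula comes with a rate only on the range of `R²`. That range is dense, and the
  -- powers `J n ^ n` are contractions.
  have hlim : Tendsto (fun n : ℕ => (J n ^ n) v) atTop (𝓝 (cfcSemigroup R t v)) := by
    refine tendsto_apply_of_denseRange (C := 1) ?_ (hd.comp hd R.continuous) (fun u => ?_) v
    · filter_upwards [eventually_gt_atTop 0] with n hn
      have hn' : (0 : ℝ) < n := by exact_mod_cast hn
      exact (norm_pow_le' _ hn).trans
        (pow_le_one₀ (norm_nonneg _) (norm_cfc_resolventSymbol_le hR₀ hR₁ (by positivity)))
    · rw [tendsto_iff_norm_sub_tendsto_zero]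
      have hlim : Tendsto (fun n : ℕ => (t : ℝ) ^ 2 / n * ‖u‖) atTop (𝓝 0) := by
        simpa using (tendsto_const_div_atTop_nhds_zero_nat ((t : ℝ) ^ 2)).mul_const ‖u‖
      refine squeeze_zero' (Eventually.of_forall fun _ => norm_nonneg _) ?_ hlim
      filter_upwards [eventually_gt_atTop 0] with n hn
      exact ((J n ^ n - cfcSemigroup R t) * R * R).le_of_opNorm_le
        (norm_cfc_resolventSymbol_pow_sub_le hR₀ hR₁ ht hn) u
  refine hC.mem_of_tendsto hlim ?_
  filter_upwards [eventually_gt_atTop 0] with n hn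
  exact hpow n hn n

end Semigroup

end NeumannLap

set_option linter.unusedSectionVars false

namespace NeumannLap

/-! ### Weak directional derivatives and the chain rule -/

section WeakDerivative

variable {E : Type*} [NormedAddCommGroup E] [NormedSpace ℝ E] [FiniteDimensional ℝ E]
  [MeasurableSpace E] [BorelSpace E] {μ : Measure E}

/-- `g` is the weak derivative of `p` in the direction `e` on the set `U`. -/
def HasWeakDirDeriv (μ : Measure E) (U : Set E) (e : E) (p g : E → ℝ) : Prop :=
  ∀ φ : E → ℝ, ContDiff ℝ (⊤ : ℕ∞) φ → HasCompactSupport φ → tsupport φ ⊆ U →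
    ∫ x in U, p x * fderiv ℝ φ x e ∂μ = -∫ x in U, g x * φ x ∂μ

theorem hasCompactSupport_fderiv_apply {φ : E → ℝ} (hφ : HasCompactSupport φ) (e : E) :
    HasCompactSupport fun x => fderiv ℝ φ x e :=
  (hφ.fderiv ℝ).comp_left (g := fun T : E →L[ℝ] ℝ => T e) rfl

theorem integral_mul_inner_toLp {f g : E → ℝ} (hf : MemLp f 2 μ) (hg : MemLp g 2 μ) :
    inner ℝ (hf.toLp f) (hg.toLp g) = ∫ x, f x * g x ∂μ := by
  rw [L2.inner_def]
  refine integral_congr_ae ?_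
  filter_upwards [hf.coeFn_toLp, hg.coeFn_toLp] with x hx hy
  rw [hx, hy]
  simp [mul_comm]

/-- As a function of `s • e` the integral is the convolution of `f` with the reflection of `φ`, and
the derivative falls on the smooth factor. -/
theorem hasDerivAt_integral_mul_translate [μ.IsAddHaarMeasure] {f φ : E → ℝ}
    (hf : LocallyIntegrable f μ) (hφ : ContDiff ℝ 1 φ) (hφc : HasCompactSupport φ) (e : E)
    (s : ℝ) :
    HasDerivAt (fun s : ℝ => ∫ x, f x * φ (x - s • e) ∂μ)
      (-∫ x, f x * fderiv ℝ φ (x - s • e) e ∂μ) s := by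
  set g : E → ℝ := fun y => φ (-y) with hg
  have hgd : ContDiff ℝ 1 g := hφ.comp contDiff_neg
  have hgc : HasCompactSupport g := hφc.comp_homeomorph (Homeomorph.neg E)
  have h1 := hgc.hasFDerivAt_convolution_right (ContinuousLinearMap.mul ℝ ℝ) hf hgd (s • e)
  have h2 : HasDerivAt (fun s : ℝ => s • e) e s := by
    simpa using (hasDerivAt_id s).smul_const e
  have h3 := h1.comp_hasDerivAt s h2
  rw [convolution_precompR_apply _ hf (hgc.fderiv ℝ) (hgd.continuous_fderiv (by simp))] at h3
  have hconv : ∀ y, (MeasureTheory.convolution f g (ContinuousLinearMap.mul ℝ ℝ) μ) y =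
      ∫ x, f x * φ (x - y) ∂μ := by
    intro y
    simp [convolution_def, hg]
  have hfd : ∀ y, fderiv ℝ g y e = -fderiv ℝ φ (-y) e := by
    intro y
    have h5 := ((hφ.differentiable (by simp)).differentiableAt (x := -y)).hasFDerivAt.comp y
      (hasFDerivAt_id y).neg
    have h6 : fderiv ℝ g y = _ := h5.fderiv
    rw [h6]
    simp
  have h4 : (MeasureTheory.convolution f (fun a => fderiv ℝ g a e)
      (ContinuousLinearMap.mul ℝ ℝ) μ) (s • e) = -∫ x, f x * fderiv ℝ φ (x - s • e) e ∂μ := by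
    simp [convolution_def, hfd, integral_neg]
  rw [h4] at h3
  refine h3.congr_of_eventuallyEq (Eventually.of_forall fun s => ?_)
  exact (hconv _).symm

theorem memLp_translate [μ.IsAddHaarMeasure] {f : E → ℝ} (hf : MemLp f 2 μ) (v : E) :
    MemLp (fun x => f (x + v)) 2 μ :=
  hf.comp_measurePreserving (measurePreserving_add_right μ v)

theorem integral_mul_translate [μ.IsAddHaarMeasure] (f φ : E → ℝ) (v : E) :
    ∫ x, f x * φ (x - v) ∂μ = ∫ x, f (x + v) * φ x ∂μ := by
  rw [← integral_add_right_eq_self (fun x => f x * φ (x - v)) v]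
  simp

theorem integral_translate_sub_mul [μ.IsAddHaarMeasure] {f φ : E → ℝ} (hf : LocallyIntegrable f μ)
    (hφ : Continuous φ) (hφc : HasCompactSupport φ) (v : E) :
    ∫ x, (f (x + v) - f x) * φ x ∂μ = (∫ x, f x * φ (x - v) ∂μ) - ∫ x, f x * φ x ∂μ := by
  have h0 : Integrable (fun x => f x * φ x) μ :=
    hf.integrable_smul_right_of_hasCompactSupport hφ hφc
  have h1 : Integrable (fun x => f x * φ (x - v)) μ :=
    hf.integrable_smul_right_of_hasCompactSupport (g := fun x => φ (x - v)) (by fun_prop)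
      (hφc.comp_homeomorph (Homeomorph.subRight v))
  have h2 : Integrable (fun x => f (x + v) * φ x) μ := by
    simpa using h1.comp_add_right v
  rw [integral_mul_translate, ← integral_sub h2 h0]
  simp only [sub_mul]

section WholeSpace

variable [μ.IsAddHaarMeasure] {w h : E → ℝ} {e : E}

/-- The increment of an `L²` function under translation by `s • e`. -/
noncomputable def translateIncrement (hw : MemLp w 2 μ) (e : E) (s : ℝ) : Lp ℝ 2 μ :=
  ((memLp_translate hw (s • e)).sub hw).toLp _

theorem inner_translateIncrement_toLp (hw : MemLp w 2 μ) {ψ : E → ℝ} (hψ : MemLp ψ 2 μ) (s : ℝ) :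
    inner ℝ (translateIncrement hw e s) (hψ.toLp ψ) = ∫ x, (w (x + s • e) - w x) * ψ x ∂μ :=
  integral_mul_inner_toLp _ hψ

theorem HasWeakDirDeriv.hasDerivAt_integral_mul_translate (hw : MemLp w 2 μ)
    (hwh : HasWeakDirDeriv μ Set.univ e w h) {φ : E → ℝ} (hφ : ContDiff ℝ (⊤ : ℕ∞) φ)
    (hφc : HasCompactSupport φ) (s : ℝ) :
    HasDerivAt (fun s : ℝ => ∫ x, w x * φ (x - s • e) ∂μ) (∫ x, h x * φ (x - s • e) ∂μ) s := by
  have h1 := NeumannLap.hasDerivAt_integral_mul_translate (hw.locallyIntegrable (by norm_num))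
    (hφ.of_le (by exact_mod_cast le_top)) hφc e s
  have h2 := hwh (fun x => φ (x - s • e)) (hφ.comp (contDiff_id.sub contDiff_const))
    (hφc.comp_homeomorph (Homeomorph.subRight (s • e))) (Set.subset_univ _)
  simp only [Measure.restrict_univ, fderiv_comp_sub] at h2
  rwa [h2, neg_neg] at h1

/-- Mean value inequality in `s`: the pairing has derivative `∫ h(x) φ(x - s e)`, bounded by
Cauchy–Schwarz and translation invariance. -/
theorem HasWeakDirDeriv.abs_inner_translateIncrement_le (hw : MemLp w 2 μ) (hh : MemLp h 2 μ)
    (hwh : HasWeakDirDeriv μ Set.univ e w h) {φ : E → ℝ} (hφ : ContDiff ℝ (⊤ : ℕ∞) φ)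
    (hφc : HasCompactSupport φ) (hφm : MemLp φ 2 μ) (s : ℝ) :
    |inner ℝ (translateIncrement hw e s) (hφm.toLp φ)| ≤
      |s| * ‖hh.toLp h‖ * ‖hφm.toLp φ‖ := by
  rw [inner_translateIncrement_toLp, integral_translate_sub_mul (hw.locallyIntegrable (by norm_num))
    hφ.continuous hφc]
  have hb : ∀ r ∈ (Set.univ : Set ℝ), ‖∫ x, h x * φ (x - r • e) ∂μ‖ ≤
      ‖hh.toLp h‖ * ‖hφm.toLp φ‖ := by
    intro r _
    have hm : MemLp (fun x => φ (x - r • e)) 2 μ := by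
      simpa [sub_eq_add_neg] using memLp_translate hφm (-(r • e))
    rw [← integral_mul_inner_toLp hh hm]
    refine (abs_real_inner_le_norm _ _).trans (le_of_eq ?_)
    congr 1
    rw [Lp.norm_toLp, Lp.norm_toLp]
    congr 1
    exact eLpNorm_comp_measurePreserving hφm.aestronglyMeasurable
      (measurePreserving_sub_right μ (r • e))
  have := Convex.norm_image_sub_le_of_norm_hasDerivWithin_le (x := 0) (y := s)
    (fun r _ => (hwh.hasDerivAt_integral_mul_translate hw hφ hφc r).hasDerivWithinAt) hb
    convex_univ (Set.mem_univ _) (Set.mem_univ _)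
  simp only [zero_smul, sub_zero, Real.norm_eq_abs] at this
  linarith

/-- By duality: the bound against test functions extends to all of `L²` by density, and is then used
for the increment itself. -/
theorem HasWeakDirDeriv.norm_translateIncrement_le (hw : MemLp w 2 μ) (hh : MemLp h 2 μ)
    (hwh : HasWeakDirDeriv μ Set.univ e w h) (s : ℝ) :
    ‖translateIncrement hw e s‖ ≤ |s| * ‖hh.toLp h‖ := by
  set W := translateIncrement hw e s
  have key : ∀ Ψ : Lp ℝ 2 μ, |inner ℝ W Ψ| ≤ |s| * ‖hh.toLp h‖ * ‖Ψ‖ := by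
    intro Ψ
    have hc : IsClosed {Ψ : Lp ℝ 2 μ | |inner ℝ W Ψ| ≤ |s| * ‖hh.toLp h‖ * ‖Ψ‖} :=
      isClosed_le (by fun_prop) (by fun_prop)
    have hd : Dense {f : Lp ℝ 2 μ | ∃ (g : E → ℝ), f =ᵐ[μ] g ∧ HasCompactSupport g ∧
        ContDiff ℝ (⊤ : ℕ∞) g} := Lp.dense_hasCompactSupport_contDiff (by norm_num)
    refine hc.closure_subset_iff.2 ?_ (hd Ψ)
    rintro f ⟨φ, hfφ, hφc, hφ⟩
    have hφm : MemLp φ 2 μ := (Lp.memLp f).ae_eq hfφ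
    have : f = hφm.toLp φ := Lp.ext (hfφ.trans hφm.coeFn_toLp.symm)
    rw [this]
    exact hwh.abs_inner_translateIncrement_le hw hh hφ hφc hφm s
  have := key W
  rw [real_inner_self_eq_norm_sq, abs_of_nonneg (sq_nonneg _)] at this
  rcases (norm_nonneg W).eq_or_lt with h0 | h0
  · rw [← h0]
    positivity
  · nlinarith

/-- The difference quotients converge weakly in `L²` to the weak derivative. -/
theorem HasWeakDirDeriv.tendsto_integral_slope (hw : MemLp w 2 μ) (hh : MemLp h 2 μ)
    (hwh : HasWeakDirDeriv μ Set.univ e w h) {ψ : E → ℝ} (hψ : MemLp ψ 2 μ) :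
    Tendsto (fun s : ℝ => s⁻¹ * ∫ x, (w (x + s • e) - w x) * ψ x ∂μ) (𝓝[≠] 0)
      (𝓝 (∫ x, h x * ψ x ∂μ)) := by
  set D : Set (Lp ℝ 2 μ) := {f : Lp ℝ 2 μ | ∃ (g : E → ℝ), f =ᵐ[μ] g ∧ HasCompactSupport g ∧
        ContDiff ℝ (⊤ : ℕ∞) g} with hD
  have hd : Dense D := Lp.dense_hasCompactSupport_contDiff (by norm_num)
  have := tendsto_apply_of_denseRange (l := 𝓝[≠] (0 : ℝ)) (C := ‖hh.toLp h‖)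
    (T := fun s : ℝ => innerSL ℝ (s⁻¹ • translateIncrement hw e s)) (T₀ := innerSL ℝ (hh.toLp h))
    ?_ hd.denseRange_val (fun f => ?_) (hψ.toLp ψ)
  · simpa only [innerSL_apply_apply, integral_mul_inner_toLp, real_inner_smul_left,
      inner_translateIncrement_toLp] using this
  · filter_upwards [self_mem_nhdsWithin] with s hs
    rw [innerSL_apply_norm, norm_smul, norm_inv, Real.norm_eq_abs,
      inv_mul_le_iff₀ (abs_pos.2 hs)]
    exact hwh.norm_translateIncrement_le hw hh s
  · obtain ⟨f, φ, hfφ, hφc, hφ⟩ := f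
    have hφm : MemLp φ 2 μ := (Lp.memLp f).ae_eq hfφ
    have : f = hφm.toLp φ := Lp.ext (hfφ.trans hφm.coeFn_toLp.symm)
    simp only [this, innerSL_apply_apply, integral_mul_inner_toLp, real_inner_smul_left,
      inner_translateIncrement_toLp]
    have hder := (hwh.hasDerivAt_integral_mul_translate hw hφ hφc 0).tendsto_slope_zero
    simp only [zero_smul, sub_zero, zero_add, smul_eq_mul] at hder
    refine hder.congr fun s => ?_
    rw [integral_translate_sub_mul (hw.locallyIntegrable (by norm_num)) hφ.continuous hφc]

/-- By `hC`, the difference quotient of `G ∘ w` against `φ` is that of `w` against `G'(w) φ`, up to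
an error controlled by `s⁻¹ ‖w(· + s e) - w‖² = O(s)`. The latter quotient converges since `G'(w) φ
∈ L²`. -/
theorem HasWeakDirDeriv.comp_univ (hw : MemLp w 2 μ) (hh : MemLp h 2 μ)
    (hwh : HasWeakDirDeriv μ Set.univ e w h) {G G' : ℝ → ℝ} {B B' C : ℝ}
    (hGc : Continuous G) (hG'c : Continuous G') (hB : ∀ r, |G r| ≤ B) (hB' : ∀ r, |G' r| ≤ B')
    (hC : ∀ a b, |G b - G a - G' a * (b - a)| ≤ C * (b - a) ^ 2) :
    HasWeakDirDeriv μ Set.univ e (fun x => G (w x)) (fun x => G' (w x) * h x) := by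
  intro φ hφ hφc _
  simp only [Measure.restrict_univ]
  have hGm : AEStronglyMeasurable (fun x => G (w x)) μ :=
    hGc.comp_aestronglyMeasurable hw.aestronglyMeasurable
  have hG'm : AEStronglyMeasurable (fun x => G' (w x)) μ :=
    hG'c.comp_aestronglyMeasurable hw.aestronglyMeasurable
  have hGloc : LocallyIntegrable (fun x => G (w x)) μ :=
    (memLp_top_of_bound hGm B (Eventually.of_forall fun x => hB _)).locallyIntegrable le_top
  have hφm : MemLp φ 2 μ := hφ.continuous.memLp_of_hasCompactSupport hφc
  have hψ : MemLp (fun x => G' (w x) * φ x) 2 μ :=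
    hφm.of_le_mul (c := B') (hG'm.mul hφm.aestronglyMeasurable) (Eventually.of_forall fun x => by
      rw [norm_mul]
      gcongr
      exact hB' _)
  obtain ⟨M, hM⟩ := hφ.continuous.bounded_above_of_compact_support hφc
  have hM0 : 0 ≤ M := (norm_nonneg _).trans (hM 0)
  have hC0 : 0 ≤ C := by simpa using (abs_nonneg _).trans (hC 0 1)
  have h1 := (NeumannLap.hasDerivAt_integral_mul_translate hGloc
    (hφ.of_le (by exact_mod_cast le_top)) hφc e 0).tendsto_slope_zero
  simp only [zero_smul, sub_zero, zero_add, smul_eq_mul] at h1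
  have h2 := hwh.tendsto_integral_slope hw hh hψ
  have herr : ∀ s : ℝ, s ≠ 0 →
      ‖s⁻¹ * ((∫ x, G (w x) * φ (x - s • e) ∂μ) - ∫ x, G (w x) * φ x ∂μ) -
        s⁻¹ * ∫ x, (w (x + s • e) - w x) * (G' (w x) * φ x) ∂μ‖ ≤
      |s| * (C * M * ‖hh.toLp h‖ ^ 2) := by
    intro s hs
    have hinc : MemLp (fun x => w (x + s • e) - w x) 2 μ := (memLp_translate hw (s • e)).sub hw
    have hi1 : Integrable (fun x => (G (w (x + s • e)) - G (w x)) * φ x) μ := by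
      have := (hGloc.integrable_smul_right_of_hasCompactSupport (g := fun x => φ (x - s • e))
        (by fun_prop) (hφc.comp_homeomorph (Homeomorph.subRight (s • e)))).comp_add_right (s • e)
      have h3 := hGloc.integrable_smul_right_of_hasCompactSupport hφ.continuous hφc
      simp only [smul_eq_mul, add_sub_cancel_right] at this h3
      exact (this.sub h3).congr (Eventually.of_forall fun x => (sub_mul _ _ _).symm)
    have hi2 : Integrable (fun x => (w (x + s • e) - w x) * (G' (w x) * φ x)) μ :=
      hinc.integrable_mul hψ
    have hsq : ∫ x, (w (x + s • e) - w x) ^ 2 ∂μ ≤ s ^ 2 * ‖hh.toLp h‖ ^ 2 := by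
      have h3 := integral_mul_inner_toLp hinc hinc
      have h4 := hwh.norm_translateIncrement_le hw hh s
      rw [real_inner_self_eq_norm_sq] at h3
      simp only [← pow_two] at h3
      rw [← h3, ← sq_abs s, ← mul_pow]
      exact pow_le_pow_left₀ (norm_nonneg _) h4 2
    rw [← integral_translate_sub_mul hGloc hφ.continuous hφc, ← mul_sub, ← integral_sub hi1 hi2,
      norm_mul, norm_inv, Real.norm_eq_abs, inv_mul_le_iff₀ (abs_pos.2 hs)]
    have hle : ∀ x, ‖(G (w (x + s • e)) - G (w x)) * φ x -
        (w (x + s • e) - w x) * (G' (w x) * φ x)‖ ≤ C * M * (w (x + s • e) - w x) ^ 2 := by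
      intro x
      have : (G (w (x + s • e)) - G (w x)) * φ x - (w (x + s • e) - w x) * (G' (w x) * φ x) =
          (G (w (x + s • e)) - G (w x) - G' (w x) * (w (x + s • e) - w x)) * φ x := by ring
      rw [this, norm_mul]
      calc _ ≤ (C * (w (x + s • e) - w x) ^ 2) * M := by
            gcongr
            · exact hC _ _
            · exact hM x
        _ = _ := by ring
    calc _ ≤ ∫ x, C * M * (w (x + s • e) - w x) ^ 2 ∂μ :=
          norm_integral_le_of_norm_le (hinc.integrable_sq.const_mul _) (Eventually.of_forall hle)
      _ = C * M * ∫ x, (w (x + s • e) - w x) ^ 2 ∂μ := integral_const_mul _ _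
      _ ≤ C * M * (s ^ 2 * ‖hh.toLp h‖ ^ 2) := by gcongr
      _ = |s| * (|s| * (C * M * ‖hh.toLp h‖ ^ 2)) := by rw [← sq_abs]; ring
  have hzero : Tendsto (fun s : ℝ => |s| * (C * M * ‖hh.toLp h‖ ^ 2)) (𝓝[≠] 0) (𝓝 0) := by
    have : Continuous fun s : ℝ => |s| * (C * M * ‖hh.toLp h‖ ^ 2) := by fun_prop
    simpa using (this.tendsto 0).mono_left nhdsWithin_le_nhds
  have h3 := squeeze_zero_norm' (eventually_mem_nhdsWithin.mono herr) hzero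
  have h4 := tendsto_nhds_unique (h1.sub h2) h3
  have h5 : ∫ x, h x * (G' (w x) * φ x) ∂μ = ∫ x, G' (w x) * h x * φ x ∂μ := by
    congr 1; ext x; ring
  rw [h5] at h4
  linarith

end WholeSpace

/-- The cutoff is `1` near `K`, not merely on it, so its derivative vanishes on `K`. -/
theorem exists_contDiff_eq_one_nhdsSet {K U : Set E} (hK : IsCompact K) (hU : IsOpen U)
    (hKU : K ⊆ U) :
    ∃ χ : E → ℝ, ContDiff ℝ (⊤ : ℕ∞) χ ∧ HasCompactSupport χ ∧ tsupport χ ⊆ U ∧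
      ∀ᶠ x in 𝓝ˢ K, χ x = 1 := by
  obtain ⟨L, hL, hKL, hLU⟩ := exists_compact_between hK hU hKU
  obtain ⟨χ, h1, h0, -⟩ := exists_contMDiffMap_one_nhds_of_subset_interior
    (modelWithCornersSelf ℝ E) (n := (⊤ : ℕ∞)) hK.isClosed hKL
  have hs : tsupport χ ⊆ L := closure_minimal (fun x hx => by
    by_contra hxL
    exact hx (h0 x hxL)) hL.isClosed
  exact ⟨χ, χ.contMDiff.contDiff, hL.of_isClosed_subset (isClosed_tsupport _) hs, hs.trans hLU, h1⟩

/-- Multiplication by a cutoff function extends weak derivatives to the whole space. -/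
theorem HasWeakDirDeriv.cutoff [IsFiniteMeasureOnCompacts μ] {U : Set E} (hU : IsOpen U) {e : E}
    {p g χ : E → ℝ} (hp : MemLp p 2 (μ.restrict U)) (hg : MemLp g 2 (μ.restrict U))
    (hpg : HasWeakDirDeriv μ U e p g) (hχ : ContDiff ℝ (⊤ : ℕ∞) χ) (hχc : HasCompactSupport χ)
    (hχU : tsupport χ ⊆ U) :
    HasWeakDirDeriv μ Set.univ e (U.indicator fun x => χ x * p x)
      (U.indicator fun x => χ x * g x + fderiv ℝ χ x e * p x) := by
  intro φ hφ hφc _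
  have hm := hU.measurableSet
  have hprod : ∀ x, fderiv ℝ (fun x => χ x * φ x) x e =
      χ x * fderiv ℝ φ x e + fderiv ℝ χ x e * φ x := by
    intro x
    rw [fderiv_fun_mul (hχ.differentiable (by simp)).differentiableAt
      (hφ.differentiable (by simp)).differentiableAt]
    simp [mul_comm]
  -- The product `χ φ` is admissible on `U` although `φ` need not be supported there.
  have h1 := hpg (fun x => χ x * φ x) (hχ.mul hφ) hχc.mul_right
    ((tsupport_mul_subset_left).trans hχU)
  simp only [hprod] at h1
  have hcφ : Continuous fun x => fderiv ℝ φ x e :=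
    (hφ.continuous_fderiv (by simp)).clm_apply continuous_const
  have hcχ : Continuous fun x => fderiv ℝ χ x e :=
    (hχ.continuous_fderiv (by simp)).clm_apply continuous_const
  have mem2 : ∀ {k : E → ℝ}, Continuous k → HasCompactSupport k → MemLp k 2 (μ.restrict U) :=
    fun hk hkc => (hk.memLp_of_hasCompactSupport hkc (μ := μ)).restrict U
  have hi1 : Integrable (fun x => p x * (χ x * fderiv ℝ φ x e)) (μ.restrict U) :=
    hp.integrable_mul (mem2 (hχ.continuous.mul hcφ) hχc.mul_right)
  have hi2 : Integrable (fun x => p x * (fderiv ℝ χ x e * φ x)) (μ.restrict U) :=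
    hp.integrable_mul (mem2 (hcχ.mul hφ.continuous) hφc.mul_left)
  have hi3 : Integrable (fun x => g x * (χ x * φ x)) (μ.restrict U) :=
    hg.integrable_mul (mem2 (hχ.continuous.mul hφ.continuous) hφc.mul_left)
  simp only [mul_add] at h1
  rw [integral_add hi1 hi2] at h1
  have hl : ∫ x in Set.univ, U.indicator (fun x => χ x * p x) x * fderiv ℝ φ x e ∂μ =
      ∫ x in U, p x * (χ x * fderiv ℝ φ x e) ∂μ := by
    rw [Measure.restrict_univ, ← integral_indicator hm]
    congr 1
    ext x
    by_cases hx : x ∈ U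
    · simp [hx]; ring
    · simp [hx]
  have hr : ∫ x in Set.univ, U.indicator (fun x => χ x * g x + fderiv ℝ χ x e * p x) x * φ x ∂μ =
      (∫ x in U, g x * (χ x * φ x) ∂μ) + ∫ x in U, p x * (fderiv ℝ χ x e * φ x) ∂μ := by
    rw [← integral_add hi3 hi2, Measure.restrict_univ, ← integral_indicator hm]
    congr 1
    ext x
    by_cases hx : x ∈ U
    · simp [hx]; ring
    · simp [hx]
  rw [hl, hr]
  linarith

/-- The chain rule for weak derivatives. -/
theorem HasWeakDirDeriv.comp [μ.IsAddHaarMeasure] {U : Set E} (hU : IsOpen U) {e : E}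
    {p g : E → ℝ} (hp : MemLp p 2 (μ.restrict U)) (hg : MemLp g 2 (μ.restrict U))
    (hpg : HasWeakDirDeriv μ U e p g) {G G' : ℝ → ℝ} {B B' C : ℝ}
    (hGc : Continuous G) (hG'c : Continuous G') (hB : ∀ r, |G r| ≤ B) (hB' : ∀ r, |G' r| ≤ B')
    (hC : ∀ a b, |G b - G a - G' a * (b - a)| ≤ C * (b - a) ^ 2) :
    HasWeakDirDeriv μ U e (fun x => G (p x)) (fun x => G' (p x) * g x) := by
  intro φ hφ hφc hφU
  -- The cutoff is adapted to the given `φ`: on `tsupport φ` the extended function and its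
  -- derivative agree with `p` and `g`, so the whole-space chain rule can be tested with `φ`.
  obtain ⟨χ, hχ, hχc, hχU, hχ1⟩ := exists_contDiff_eq_one_nhdsSet hφc hU hφU
  have hcχ : Continuous fun x => fderiv ℝ χ x e :=
    (hχ.continuous_fderiv (by simp)).clm_apply continuous_const
  have memMul : ∀ {k f : E → ℝ}, Continuous k → HasCompactSupport k → MemLp f 2 (μ.restrict U) →
      MemLp (fun x => k x * f x) 2 (μ.restrict U) := by
    intro k f hk hkc hf
    obtain ⟨M, hM⟩ := hk.bounded_above_of_compact_support hkc
    exact hf.of_le_mul (c := M) (hk.aestronglyMeasurable.mul hf.aestronglyMeasurable)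
      (Eventually.of_forall fun x => by
        rw [norm_mul]
        gcongr
        exact hM x)
  have hw : MemLp (U.indicator fun x => χ x * p x) 2 μ :=
    (memLp_indicator_iff_restrict hU.measurableSet).2 (memMul hχ.continuous hχc hp)
  have hh : MemLp (U.indicator fun x => χ x * g x + fderiv ℝ χ x e * p x) 2 μ :=
    (memLp_indicator_iff_restrict hU.measurableSet).2
      ((memMul hχ.continuous hχc hg).add (memMul hcχ (hasCompactSupport_fderiv_apply hχc e) hp))
  have h1 := (hpg.cutoff hU hp hg hχ hχc hχU).comp_univ hw hh hGc hG'c hB hB' hC φ hφ hφc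
    (Set.subset_univ _)
  simp only [Measure.restrict_univ] at h1
  rw [← integral_indicator hU.measurableSet, ← integral_indicator hU.measurableSet]
  have hχ1' : ∀ x ∈ tsupport φ, χ x = 1 ∧ fderiv ℝ χ x = 0 := by
    intro x hx
    have h2 : χ =ᶠ[𝓝 x] fun _ => 1 := (eventually_nhdsSet_iff_forall.1 hχ1) x hx
    exact ⟨h2.eq_of_nhds, by simp [h2.fderiv_eq]⟩
  convert h1 using 2
  · ext x
    by_cases hx : x ∈ tsupport φ
    · simp [hφU hx, (hχ1' x hx).1]
    · have : fderiv ℝ φ x = 0 := by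
        by_contra h2
        exact hx (support_fderiv_subset ℝ h2)
      simp [Set.indicator, this]
  · congr 1
    ext x
    by_cases hx : x ∈ tsupport φ
    · simp [hφU hx, (hχ1' x hx).1, (hχ1' x hx).2]
    · simp [Set.indicator, image_eq_zero_of_notMem_tsupport hx]

end WeakDerivative

end NeumannLap

namespace NeumannLap

/-! ### The abstract resolvent `J J*` of a form -/

section FormResolvent

variable {H K : Type*} [NormedAddCommGroup H] [InnerProductSpace ℂ H] [CompleteSpace H]
  [NormedAddCommGroup K] [InnerProductSpace ℂ K] (V : Submodule ℂ K) [CompleteSpace V]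
  (π : K →L[ℂ] H)

/-- The solution operator `v ↦ π z` of the variational problem `⟪w, z⟫ = ⟪π w, v⟫` for all `w ∈ V`,
where `z ∈ V`. -/
noncomputable def formResolvent : H →L[ℂ] H :=
  (π.comp V.subtypeL).comp (π.comp V.subtypeL).adjoint

theorem formResolvent_nonneg : 0 ≤ formResolvent V π :=
  (ContinuousLinearMap.nonneg_iff_isPositive _).2
    (ContinuousLinearMap.isPositive_self_comp_adjoint _)

variable {π} in
theorem norm_formResolvent_le (hπ : ‖π‖ ≤ 1) : ‖formResolvent V π‖ ≤ 1 := by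
  have h : ‖π.comp V.subtypeL‖ ≤ 1 :=
    (ContinuousLinearMap.opNorm_comp_le _ _).trans
      (mul_le_one₀ hπ (norm_nonneg _) V.norm_subtypeL_le)
  refine (ContinuousLinearMap.opNorm_comp_le _ _).trans ?_
  rw [LinearIsometryEquiv.norm_map]
  exact mul_le_one₀ h (norm_nonneg _) h

/-- The variational problem is the defining identity of the adjoint, solved by `z = J* v`. -/
theorem formResolvent_eq_iff {v u : H} :
    formResolvent V π v = u ↔ ∃ z ∈ V, π z = u ∧ ∀ w ∈ V, inner ℂ w z = inner ℂ (π w) v := by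
  set J := π.comp V.subtypeL with hJ
  constructor
  · rintro rfl
    exact ⟨J.adjoint v, (J.adjoint v).2, rfl, fun w hw => J.adjoint_inner_right ⟨w, hw⟩ v⟩
  · rintro ⟨z, hz, rfl, h⟩
    have : J.adjoint v = ⟨z, hz⟩ := ext_inner_left ℂ fun w => by
      rw [J.adjoint_inner_right, Submodule.coe_inner]
      exact (h w w.2).symm
    rw [formResolvent, ContinuousLinearMap.comp_apply, this]
    rfl

/-- If `J J* v = 0`, then `‖J* v‖² = ⟪J J* v, v⟫ = 0`, so `v` is orthogonal to the range of `J`. -/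
theorem injective_formResolvent (h : ∀ v, (∀ w ∈ V, inner ℂ (π w) v = 0) → v = 0) :
    Function.Injective (formResolvent V π) := by
  set J := π.comp V.subtypeL with hJ
  refine (injective_iff_map_eq_zero _).2 fun v hv => h v fun w hw => ?_
  have h1 : J.adjoint v = 0 := by
    have h2 : inner ℂ (formResolvent V π v) v = 0 := by rw [hv, inner_zero_left]
    rw [formResolvent, ContinuousLinearMap.comp_apply,
      ← ContinuousLinearMap.adjoint_inner_right] at h2
    exact inner_self_eq_zero.1 h2
  have h3 := J.adjoint_inner_right ⟨w, hw⟩ v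
  rw [h1, inner_zero_right] at h3
  exact h3.symm

end FormResolvent

/-! ### The Sobolev space and the resolvent of the Neumann Laplacian -/

section SobolevSpace

variable {d : ℕ} {Ω : Opens (EuclideanSpace ℝ (Fin d))}

/-- Lebesgue measure on `Ω`. -/
local notation "volΩ" Ω => Measure.restrict volume (Ω : Set (EuclideanSpace ℝ (Fin d)))

theorem memLp_testFunction (φ : 𝓓(Ω, ℝ)) : MemLp (fun x => (φ x : ℂ)) 2 (volΩ Ω) :=
  (((Complex.continuous_ofReal.comp φ.continuous).memLp_of_hasCompactSupport
    (φ.hasCompactSupport.comp_left (g := Complex.ofReal) rfl)) :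
      MemLp (fun x => (φ x : ℂ)) 2 volume).restrict _

/-- A test function as an element of `L²(Ω)`. -/
noncomputable def testLp (φ : 𝓓(Ω, ℝ)) : L2 Ω := (memLp_testFunction φ).toLp _

theorem coeFn_testLp (φ : 𝓓(Ω, ℝ)) : ∀ᵐ x ∂(volΩ Ω), testLp φ x = (φ x : ℂ) :=
  (memLp_testFunction φ).coeFn_toLp

theorem inner_testLp (φ : 𝓓(Ω, ℝ)) (u : L2 Ω) :
    inner ℂ (testLp φ) u = ∫ x in (Ω : Set (EuclideanSpace ℝ (Fin d))), φ x • u x := by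
  rw [L2.inner_def]
  refine integral_congr_ae ?_
  filter_upwards [coeFn_testLp φ] with x hx
  rw [hx, RCLike.inner_apply, Complex.conj_ofReal, Complex.real_smul, mul_comm]

theorem integral_mul_conj (f w : L2 Ω) :
    ∫ x in (Ω : Set (EuclideanSpace ℝ (Fin d))), f x * conj (w x) = inner ℂ w f := by
  rw [L2.inner_def]
  rfl

theorem integral_sum_mul_conj (g w : Fin d → L2 Ω) :
    ∫ x in (Ω : Set (EuclideanSpace ℝ (Fin d))), ∑ i, g i x * conj (w i x) =
      ∑ i, inner ℂ (w i) (g i) := by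
  rw [integral_finsetSum]
  · exact Finset.sum_congr rfl fun i _ => integral_mul_conj _ _
  · intro i _
    exact L2.integrable_inner (𝕜 := ℂ) (w i) (g i)

theorem isWeakGradient_iff_inner (u : L2 Ω) (g : Fin d → L2 Ω) :
    IsWeakGradient u g ↔
      ∀ (i : Fin d) (φ : 𝓓(Ω, ℝ)), inner ℂ (testLp (pd i φ)) u = -inner ℂ (testLp φ) (g i) := by
  simp only [IsWeakGradient, inner_testLp]

theorem normalDerivEqZero_iff_inner (T : Set (L2 Ω × (Fin d → L2 Ω))) (g : Fin d → L2 Ω)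
    (f : L2 Ω) :
    NormalDerivEqZero T g f ↔ ∀ w ∈ T, inner ℂ w.1 f + ∑ i, inner ℂ (w.2 i) (g i) = 0 := by
  simp only [NormalDerivEqZero, integral_mul_conj, integral_sum_mul_conj]

theorem setIntegral_eq_integral_of_tsupport_subset {U : Set (EuclideanSpace ℝ (Fin d))}
    {φ : EuclideanSpace ℝ (Fin d) → ℝ} {F : Type*} [NormedAddCommGroup F] [NormedSpace ℝ F]
    (hφ : tsupport φ ⊆ U) (u : EuclideanSpace ℝ (Fin d) → F) :
    ∫ x in U, φ x • u x = ∫ x, φ x • u x :=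
  setIntegral_eq_integral_of_forall_compl_eq_zero fun x hx => by
    rw [image_eq_zero_of_notMem_tsupport fun h => hx (hφ h), zero_smul]

/-- Integration by parts on the whole space, without boundary terms because of compact support. -/
theorem testLp_mem_H1Cont (φ : 𝓓(Ω, ℝ)) : (testLp φ, fun i => testLp (pd i φ)) ∈ H1Cont Ω := by
  refine ⟨fun i ψ => ?_, fun x => (φ x : ℂ),
    (Complex.continuous_ofReal.comp φ.continuous).continuousOn, coeFn_testLp φ⟩
  have h1 : ∫ x, pd i ψ x * φ x = -∫ x, ψ x * pd i φ x := by
    have int : ∀ a b : 𝓓(Ω, ℝ), Integrable (fun x => a x * b x) := fun a b =>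
      (a.continuous.mul b.continuous).integrable_of_hasCompactSupport a.hasCompactSupport.mul_right
    have hd : ∀ a : 𝓓(Ω, ℝ), Differentiable ℝ a := fun a => a.contDiff.differentiable (by simp)
    have := integral_mul_fderiv_eq_neg_fderiv_mul_of_integrable (μ := volume) (f := φ) (g := ψ)
      (v := EuclideanSpace.single i 1)
      (by simpa only [pd_apply] using int (pd i φ) ψ) (by simpa only [pd_apply] using int φ (pd i ψ))
      (int φ ψ) (fun x _ => (hd φ) x) (fun x _ => (hd ψ) x)
    simp only [← pd_apply] at this
    simpa only [mul_comm] using this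
  have key : ∀ a b : 𝓓(Ω, ℝ), ∫ x in (Ω : Set (EuclideanSpace ℝ (Fin d))), a x • testLp b x =
      ((∫ x, a x * b x : ℝ) : ℂ) := by
    intro a b
    rw [← integral_complex_ofReal]
    have : ∫ x in (Ω : Set (EuclideanSpace ℝ (Fin d))), a x • testLp b x =
        ∫ x in (Ω : Set (EuclideanSpace ℝ (Fin d))), a x • (b x : ℂ) := by
      refine integral_congr_ae ?_
      filter_upwards [coeFn_testLp b] with x hx
      rw [hx]
    rw [this, setIntegral_eq_integral_of_tsupport_subset a.tsupport_subset]
    simp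
  simp only [key, h1]
  simp

/-- The fundamental lemma of the calculus of variations; it makes the resolvent injective. -/
theorem eq_zero_of_forall_inner_testLp {v : L2 Ω}
    (hv : ∀ φ : 𝓓(Ω, ℝ), inner ℂ (testLp φ) v = 0) : v = 0 := by
  have hloc : LocallyIntegrableOn v (Ω : Set (EuclideanSpace ℝ (Fin d))) volume :=
    locallyIntegrableOn_of_locallyIntegrable_restrict
      ((Lp.memLp v).locallyIntegrable (by norm_num))
  have h := Ω.isOpen.ae_eq_zero_of_integral_contDiff_smul_eq_zero hloc fun g hg hgc hgΩ => by
    have := hv ⟨g, hg, hgc, hgΩ⟩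
    rw [inner_testLp] at this
    rw [← setIntegral_eq_integral_of_tsupport_subset hgΩ]
    exact this
  refine (Lp.eq_zero_iff_ae_eq_zero).2 ?_
  exact (ae_restrict_iff' Ω.isOpen.measurableSet).2 h

variable (Ω)

/-- The Hilbert space `L²(Ω) × L²(Ω)^d`. -/
abbrev L2Prod : Type := WithLp 2 (L2 Ω × PiLp 2 fun _ : Fin d => L2 Ω)

/-- `H¹(Ω)` as a subspace of the Hilbert space `L²(Ω) × L²(Ω)^d`. -/
noncomputable def sobolev : Submodule ℂ (L2Prod Ω) where
  carrier := {w | IsWeakGradient w.fst fun i => w.snd i}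
  zero_mem' := by
    simp only [Set.mem_ofPred_eq, isWeakGradient_iff_inner]
    intro i φ
    simp
  add_mem' := by
    intro a b ha hb
    simp only [Set.mem_ofPred_eq, isWeakGradient_iff_inner] at ha hb ⊢
    intro i φ
    simp only [WithLp.add_fst, WithLp.add_snd, PiLp.add_apply, inner_add_right, ha i φ, hb i φ]
    ring
  smul_mem' := by
    intro c a ha
    simp only [Set.mem_ofPred_eq, isWeakGradient_iff_inner] at ha ⊢
    intro i φ
    simp only [WithLp.smul_fst, WithLp.smul_snd, PiLp.smul_apply, inner_smul_right, ha i φ]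
    ring

theorem isClosed_sobolev : IsClosed (sobolev Ω : Set (L2Prod Ω)) := by
  have : (sobolev Ω : Set (L2Prod Ω)) = ⋂ (i : Fin d), ⋂ (φ : 𝓓(Ω, ℝ)),
      {w | inner ℂ (testLp (pd i φ)) w.fst = -inner ℂ (testLp φ) (w.snd i)} := by
    ext w
    simp only [Set.mem_iInter, Set.mem_ofPred_eq]
    exact isWeakGradient_iff_inner _ _
  rw [this]
  refine isClosed_iInter fun i => isClosed_iInter fun φ => isClosed_eq ?_ ?_
  · exact Continuous.inner continuous_const (WithLp.continuous_fst ..)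
  · exact (Continuous.inner continuous_const
      ((PiLp.continuous_apply 2 _ i).comp (WithLp.continuous_snd ..))).neg

/-- The projection of `L²(Ω) × L²(Ω)^d` onto the first component. -/
noncomputable def fstL2Prod : L2Prod Ω →L[ℂ] L2 Ω :=
  WithLp.fstL 2 ℂ (L2 Ω) (PiLp 2 fun _ : Fin d => L2 Ω)

theorem norm_fstL2Prod_le : ‖fstL2Prod Ω‖ ≤ 1 :=
  ContinuousLinearMap.opNorm_le_bound _ zero_le_one fun w => by
    rw [one_mul]
    exact WithLp.norm_fst_le (p := 2) (α := L2 Ω) (β := PiLp 2 fun _ : Fin d => L2 Ω) w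

/-- The resolvent `(1 - Δ)⁻¹` of the Neumann Laplacian. -/
noncomputable def neumannResolvent : L2 Ω →L[ℂ] L2 Ω :=
  haveI := (isClosed_sobolev Ω).completeSpace_coe
  formResolvent (sobolev Ω) (fstL2Prod Ω)

theorem neumannResolvent_nonneg : 0 ≤ neumannResolvent Ω :=
  haveI := (isClosed_sobolev Ω).completeSpace_coe
  formResolvent_nonneg _ _

theorem norm_neumannResolvent_le : ‖neumannResolvent Ω‖ ≤ 1 :=
  haveI := (isClosed_sobolev Ω).completeSpace_coe
  norm_formResolvent_le _ (norm_fstL2Prod_le Ω)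

variable {Ω}

theorem neumannResolvent_eq_iff {v u : L2 Ω} :
    neumannResolvent Ω v = u ↔ ∃ g : Fin d → L2 Ω, IsWeakGradient u g ∧
      ∀ w ∈ H1 Ω, inner ℂ w.1 u + ∑ i, inner ℂ (w.2 i) (g i) = inner ℂ w.1 v := by
  have := (isClosed_sobolev Ω).completeSpace_coe
  have h : neumannResolvent Ω v = u ↔ _ := formResolvent_eq_iff (sobolev Ω) (fstL2Prod Ω)
  rw [h]
  constructor
  · rintro ⟨z, hz, rfl, hw⟩
    refine ⟨fun i => z.snd i, hz, fun w hwH => ?_⟩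
    have h1 := hw (WithLp.toLp 2 (w.1, WithLp.toLp 2 w.2)) hwH
    rw [WithLp.prod_inner_apply, PiLp.inner_apply] at h1
    exact h1
  · rintro ⟨g, hg, hw⟩
    refine ⟨WithLp.toLp 2 (u, WithLp.toLp 2 g), hg, rfl, fun w hwH => ?_⟩
    rw [WithLp.prod_inner_apply, PiLp.inner_apply]
    exact hw (w.fst, fun i => w.snd i) hwH

theorem injective_neumannResolvent : Function.Injective (neumannResolvent Ω) :=
  haveI := (isClosed_sobolev Ω).completeSpace_coe
  injective_formResolvent (sobolev Ω) (fstL2Prod Ω) fun _ hv =>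
    eq_zero_of_forall_inner_testLp fun φ =>
      hv (WithLp.toLp 2 (testLp φ, WithLp.toLp 2 fun i => testLp (pd i φ))) (testLp_mem_H1Cont φ).1

/-- Green's formula tested with `φ`, followed by the definition of the weak gradient tested with
`∂ᵢφ`, already determines the distributional Laplacian. -/
theorem isWeakLaplacian_of_normalDerivEqZero {T : Set (L2 Ω × (Fin d → L2 Ω))}
    (hT : ∀ φ : 𝓓(Ω, ℝ), (testLp φ, fun i => testLp (pd i φ)) ∈ T) {u f : L2 Ω}
    {g : Fin d → L2 Ω} (hg : IsWeakGradient u g) (hf : NormalDerivEqZero T g f) :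
    IsWeakLaplacian u f := by
  intro φ
  have h1 := (normalDerivEqZero_iff_inner T g f).1 hf _ (hT φ)
  have h2 : ∫ x in (Ω : Set (EuclideanSpace ℝ (Fin d))), (∑ i : Fin d, pd i (pd i φ) x) • u x =
      ∑ i, inner ℂ (testLp (pd i (pd i φ))) u := by
    simp only [Finset.sum_smul, inner_testLp]
    refine integral_finsetSum _ fun i _ => ?_
    refine (L2.integrable_inner (𝕜 := ℂ) (testLp (pd i (pd i φ))) u).congr ?_
    filter_upwards [coeFn_testLp (pd i (pd i φ))] with x hx
    rw [hx, RCLike.inner_apply, Complex.conj_ofReal, Complex.real_smul, mul_comm]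
  rw [h2, ← inner_testLp]
  simp only [fun i => (isWeakGradient_iff_inner u g).1 hg i (pd i φ), Finset.sum_neg_distrib]
  simp only at h1
  linear_combination -h1

/-- Adding `⟪w, u⟫` to both sides turns Green's formula into the variational equation for `u` with
datum `u - f`. -/
theorem mem_neumannLaplacian_iff (u f : L2 Ω) :
    (u, f) ∈ neumannLaplacian Ω ↔ neumannResolvent Ω (u - f) = u := by
  rw [neumannResolvent_eq_iff]
  have key : ∀ g : Fin d → L2 Ω, NormalDerivEqZero (H1 Ω) g f ↔ ∀ w ∈ H1 Ω,
      inner ℂ w.1 u + ∑ i, inner ℂ (w.2 i) (g i) = inner ℂ w.1 (u - f) := by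
    intro g
    rw [normalDerivEqZero_iff_inner]
    refine forall₂_congr fun w _ => ?_
    rw [inner_sub_right]
    constructor <;> intro h <;> linear_combination h
  constructor
  · rintro ⟨g, hg, -, hn⟩
    exact ⟨g, hg, (key g).1 hn⟩
  · rintro ⟨g, hg, hw⟩
    have hn := (key g).2 hw
    exact ⟨g, hg, isWeakLaplacian_of_normalDerivEqZero (fun φ => (testLp_mem_H1Cont φ).1) hg hn, hn⟩

theorem normalDerivEqZero_closure {T : Set (L2 Ω × (Fin d → L2 Ω))} {g : Fin d → L2 Ω} {f : L2 Ω}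
    (h : NormalDerivEqZero T g f) : NormalDerivEqZero (closure T) g f := by
  rw [normalDerivEqZero_iff_inner] at h ⊢
  have hc : IsClosed {w : L2 Ω × (Fin d → L2 Ω) |
      inner ℂ w.1 f + ∑ i, inner ℂ (w.2 i) (g i) = 0} :=
    isClosed_eq (by fun_prop) continuous_const
  exact fun w hw => closure_minimal h hc hw

theorem neumannLaplacianCont_eq (h : H1 Ω ⊆ closure (H1Cont Ω)) :
    neumannLaplacianCont Ω = neumannLaplacian Ω := by
  ext ⟨u, f⟩
  constructor
  · rintro ⟨g, hg, hl, hn⟩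
    exact ⟨g, hg, hl, fun w hw => normalDerivEqZero_closure hn w (h hw)⟩
  · rintro ⟨g, hg, hl, hn⟩
    exact ⟨g, hg, hl, fun w hw => hn w hw.1⟩

end SobolevSpace

end NeumannLap

namespace NeumannLap

/-! ### A smooth substitute for the positive part -/

section Truncation

/-- A smooth bounded increasing function that vanishes exactly on `(-∞, M]`. -/
noncomputable def smoothTruncation (M r : ℝ) : ℝ := Real.smoothTransition (r - M)

theorem contDiff_smoothTruncation (M : ℝ) {n : ℕ∞} : ContDiff ℝ n (smoothTruncation M) :=
  Real.smoothTransition.contDiff.comp (contDiff_id.sub contDiff_const)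

theorem continuous_deriv_smoothTruncation (M : ℝ) : Continuous (deriv (smoothTruncation M)) :=
  (contDiff_smoothTruncation M (n := 1)).continuous_deriv (by simp)

theorem abs_smoothTruncation_le (M r : ℝ) : |smoothTruncation M r| ≤ 1 :=
  abs_le.2 ⟨by linarith [Real.smoothTransition.nonneg (r - M), smoothTruncation.eq_def M r],
    Real.smoothTransition.le_one _⟩

theorem smoothTruncation_mul_sub_nonneg (M r : ℝ) : 0 ≤ smoothTruncation M r * (r - M) := by
  rcases le_total r M with h | h
  · rw [smoothTruncation, Real.smoothTransition.zero_of_nonpos (by linarith), zero_mul]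
  · exact mul_nonneg (Real.smoothTransition.nonneg _) (by linarith)

theorem le_of_smoothTruncation_mul_sub_eq_zero {M r : ℝ}
    (h : smoothTruncation M r * (r - M) = 0) : r ≤ M := by
  by_contra! hr
  exact (mul_pos (Real.smoothTransition.pos_of_pos (sub_pos.2 hr)) (sub_pos.2 hr)).ne' h

theorem deriv_smoothTruncation_nonneg (M r : ℝ) : 0 ≤ deriv (smoothTruncation M) r :=
  Monotone.deriv_nonneg fun _ _ h => Real.smoothTransition.monotone (by linarith)

theorem hasCompactSupport_deriv_smoothTruncation (M : ℝ) :
    HasCompactSupport (deriv (smoothTruncation M)) := by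
  refine HasCompactSupport.intro (isCompact_Icc (a := M) (b := M + 1)) fun r hr => ?_
  rw [Set.mem_Icc, not_and_or, not_le, not_le] at hr
  rcases hr with hr | hr
  · have : smoothTruncation M =ᶠ[𝓝 r] fun _ => 0 := by
      filter_upwards [Iio_mem_nhds hr] with x hx
      exact Real.smoothTransition.zero_of_nonpos (by linarith [Set.mem_Iio.1 hx])
    rw [this.deriv_eq, deriv_const]
  · have : smoothTruncation M =ᶠ[𝓝 r] fun _ => 1 := by
      filter_upwards [Ioi_mem_nhds hr] with x hx
      exact Real.smoothTransition.one_of_one_le (by linarith [Set.mem_Ioi.1 hx])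
    rw [this.deriv_eq, deriv_const]

/-- Mean value inequality for `r ↦ G r - G'(a) r`; it supplies the quadratic remainder that the
chain rule requires. -/
theorem abs_sub_sub_deriv_mul_le_of_lipschitzWith {G : ℝ → ℝ} (hG : Differentiable ℝ G) {C : ℝ≥0}
    (hC : LipschitzWith C (deriv G)) (a b : ℝ) :
    |G b - G a - deriv G a * (b - a)| ≤ C * (b - a) ^ 2 := by
  have h := Convex.norm_image_sub_le_of_norm_hasDerivWithin_le (s := Set.uIcc a b)
    (f := fun r => G r - deriv G a * r) (f' := fun r => deriv G r - deriv G a) (C := C * |b - a|)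
    (fun r _ => by
      have h1 := (hG r).hasDerivAt.sub ((hasDerivAt_id' r).const_mul (deriv G a))
      rw [mul_one] at h1
      exact h1.hasDerivWithinAt)
    (fun r hr => by
      have h1 := hC.dist_le_mul r a
      rw [Real.dist_eq, Real.dist_eq] at h1
      refine h1.trans ?_
      gcongr C * ?_
      exact Set.abs_sub_left_of_mem_uIcc hr)
    (convex_uIcc a b) Set.left_mem_uIcc Set.right_mem_uIcc
  simp only [Real.norm_eq_abs] at h
  calc _ = |G b - deriv G a * b - (G a - deriv G a * a)| := by congr 1; ring
    _ ≤ C * |b - a| * |b - a| := h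
    _ = C * (b - a) ^ 2 := by rw [mul_assoc, abs_mul_abs_self, pow_two]

end Truncation

/-! ### Truncation in H¹ and Stampacchia's argument -/

section Invariance

variable {d : ℕ} {Ω : Opens (EuclideanSpace ℝ (Fin d))}

theorem integrable_testFunction_smul (φ : 𝓓(Ω, ℝ)) (u : L2 Ω) :
    Integrable (fun x => φ x • u x) (volume.restrict (Ω : Set (EuclideanSpace ℝ (Fin d)))) := by
  refine (L2.integrable_inner (𝕜 := ℂ) (testLp φ) u).congr ?_
  filter_upwards [coeFn_testLp φ] with x hx
  rw [hx, RCLike.inner_apply, Complex.conj_ofReal, Complex.real_smul, mul_comm]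

theorem IsWeakGradient.hasWeakDirDeriv_re {u : L2 Ω} {g : Fin d → L2 Ω} (h : IsWeakGradient u g)
    (i : Fin d) :
    HasWeakDirDeriv volume (Ω : Set (EuclideanSpace ℝ (Fin d))) (EuclideanSpace.single i 1)
      (fun x => (u x).re) (fun x => (g i x).re) := by
  intro φ hφ hφc hφΩ
  set ψ : 𝓓(Ω, ℝ) := ⟨φ, hφ, hφc, hφΩ⟩ with hψ
  have key : ∀ (a : 𝓓(Ω, ℝ)) (v : L2 Ω),
      (∫ x in (Ω : Set (EuclideanSpace ℝ (Fin d))), a x • v x).re =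
        ∫ x in (Ω : Set (EuclideanSpace ℝ (Fin d))), (v x).re * a x := by
    intro a v
    have := Complex.reCLM.integral_comp_comm (integrable_testFunction_smul a v)
    rw [← Complex.reCLM_apply, ← this]
    congr 1
    ext x
    simp [mul_comm]
  have h1 := congrArg Complex.re (h i ψ)
  rw [Complex.neg_re, key, key] at h1
  simp only [pd_apply] at h1
  exact h1

theorem isWeakGradient_of_hasWeakDirDeriv {p : EuclideanSpace ℝ (Fin d) → ℝ}
    {q : Fin d → EuclideanSpace ℝ (Fin d) → ℝ}
    (h : ∀ i, HasWeakDirDeriv volume (Ω : Set (EuclideanSpace ℝ (Fin d)))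
      (EuclideanSpace.single i 1) p (q i)) {u : L2 Ω} {g : Fin d → L2 Ω}
    (hu : ∀ᵐ x ∂(volume.restrict (Ω : Set (EuclideanSpace ℝ (Fin d)))), u x = (p x : ℂ))
    (hg : ∀ i, ∀ᵐ x ∂(volume.restrict (Ω : Set (EuclideanSpace ℝ (Fin d)))),
      g i x = (q i x : ℂ)) :
    IsWeakGradient u g := by
  intro i φ
  have key : ∀ (a : 𝓓(Ω, ℝ)) (v : L2 Ω) (r : EuclideanSpace ℝ (Fin d) → ℝ),
      (∀ᵐ x ∂(volume.restrict (Ω : Set (EuclideanSpace ℝ (Fin d)))), v x = (r x : ℂ)) →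
      ∫ x in (Ω : Set (EuclideanSpace ℝ (Fin d))), a x • v x =
        ((∫ x in (Ω : Set (EuclideanSpace ℝ (Fin d))), r x * a x : ℝ) : ℂ) := by
    intro a v r hr
    rw [← integral_complex_ofReal]
    refine integral_congr_ae ?_
    filter_upwards [hr] with x hx
    rw [hx]
    simp [mul_comm]
  rw [key _ _ _ hu, key _ _ _ (hg i)]
  have := h i φ φ.contDiff φ.hasCompactSupport φ.tsupport_subset
  simp only [← pd_apply] at this
  rw [this, Complex.ofReal_neg]

/-- Boundedness of `Ω` places the bounded function `G(Re u)` in `L²`, whatever the sign of `M`.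
Smoothness of the truncation lets the elementary chain rule apply. -/
theorem IsWeakGradient.exists_smoothTruncation
    (hΩ : Bornology.IsBounded (Ω : Set (EuclideanSpace ℝ (Fin d)))) {u : L2 Ω} {g : Fin d → L2 Ω}
    (h : IsWeakGradient u g) (M : ℝ) :
    ∃ (v : L2 Ω) (k : Fin d → L2 Ω), IsWeakGradient v k ∧
      (∀ᵐ x ∂(volume.restrict (Ω : Set (EuclideanSpace ℝ (Fin d)))),
        v x = (smoothTruncation M (u x).re : ℂ)) ∧
      ∀ i, ∀ᵐ x ∂(volume.restrict (Ω : Set (EuclideanSpace ℝ (Fin d)))),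
        k i x = (deriv (smoothTruncation M) (u x).re * (g i x).re : ℝ) := by
  have : IsFiniteMeasure (volume.restrict (Ω : Set (EuclideanSpace ℝ (Fin d)))) :=
    isFiniteMeasure_restrict.2 hΩ.measure_lt_top.ne
  have hre : ∀ v : L2 Ω, MemLp (fun x => (v x).re) 2
      (volume.restrict (Ω : Set (EuclideanSpace ℝ (Fin d)))) := fun v => (Lp.memLp v).re
  obtain ⟨B, hB⟩ := (continuous_deriv_smoothTruncation M).bounded_above_of_compact_support
    (hasCompactSupport_deriv_smoothTruncation M)
  obtain ⟨C, hC⟩ := ContDiff.lipschitzWith_of_hasCompactSupport (𝕂 := ℝ) (n := 1)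
    (hasCompactSupport_deriv_smoothTruncation M)
    (((contDiff_smoothTruncation M (n := 2)).iterate_deriv' 1 1)) (by simp)
  have hG := contDiff_smoothTruncation M (n := 1)
  have hw : ∀ i, HasWeakDirDeriv volume (Ω : Set (EuclideanSpace ℝ (Fin d)))
      (EuclideanSpace.single i 1) (fun x => smoothTruncation M (u x).re)
      (fun x => deriv (smoothTruncation M) (u x).re * (g i x).re) := fun i =>
    (h.hasWeakDirDeriv_re i).comp Ω.isOpen (hre u) (hre (g i)) hG.continuous
      (continuous_deriv_smoothTruncation M) (abs_smoothTruncation_le M) hB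
      (abs_sub_sub_deriv_mul_le_of_lipschitzWith (hG.differentiable (by simp)) hC)
  have m1 : MemLp (fun x => (smoothTruncation M (u x).re : ℂ)) 2
      (volume.restrict (Ω : Set (EuclideanSpace ℝ (Fin d)))) :=
    (MemLp.of_bound (hG.continuous.comp_aestronglyMeasurable (hre u).aestronglyMeasurable) 1
      (Eventually.of_forall fun x => abs_smoothTruncation_le M _)).ofReal
  have m2 : ∀ i, MemLp (fun x =>
      ((deriv (smoothTruncation M) (u x).re * (g i x).re : ℝ) : ℂ)) 2
      (volume.restrict (Ω : Set (EuclideanSpace ℝ (Fin d)))) := fun i => by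
    refine MemLp.ofReal ((hre (g i)).of_le_mul (c := B)
      (((continuous_deriv_smoothTruncation M).comp_aestronglyMeasurable
        (hre u).aestronglyMeasurable).mul (hre (g i)).aestronglyMeasurable)
      (Eventually.of_forall fun x => ?_))
    refine (norm_mul _ _).trans_le ?_
    gcongr
    exact hB _
  exact ⟨m1.toLp _, fun i => (m2 i).toLp _,
    isWeakGradient_of_hasWeakDirDeriv hw m1.coeFn_toLp fun i => (m2 i).coeFn_toLp,
    m1.coeFn_toLp, fun i => (m2 i).coeFn_toLp⟩

/-- Stampacchia's truncation argument: an upper bound on the right-hand side of the resolvent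
equation is inherited by the solution. -/
theorem re_le_of_re_sub_smul_le
    (hΩ : Bornology.IsBounded (Ω : Set (EuclideanSpace ℝ (Fin d)))) {u f : L2 Ω}
    (huf : (u, f) ∈ neumannLaplacian Ω) {h : ℝ} (hh : 0 < h) {M : ℝ}
    (hM : ∀ᵐ x ∂(volume.restrict (Ω : Set (EuclideanSpace ℝ (Fin d)))),
      (u x).re - h * (f x).re ≤ M) :
    ∀ᵐ x ∂(volume.restrict (Ω : Set (EuclideanSpace ℝ (Fin d)))), (u x).re ≤ M := by
  have : IsFiniteMeasure (volume.restrict (Ω : Set (EuclideanSpace ℝ (Fin d)))) :=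
    isFiniteMeasure_restrict.2 hΩ.measure_lt_top.ne
  obtain ⟨g, hg, -, hn⟩ := huf
  simp only at hg hn
  obtain ⟨v, k, hvk, hv, hk⟩ := hg.exists_smoothTruncation hΩ M
  have h1 := (normalDerivEqZero_iff_inner _ _ _).1 hn (v, k) hvk
  simp only at h1
  have hre : ∀ a b : L2 Ω, (inner ℂ a b).re =
      ∫ x in (Ω : Set (EuclideanSpace ℝ (Fin d))), (b x * conj (a x)).re := fun a b => by
    rw [← integral_mul_conj]
    exact (Complex.reCLM.integral_comp_comm (L2.integrable_inner (𝕜 := ℂ) a b)).symm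
  -- The integrand is `G'(Re u) (Re gᵢ)²`, so Green's formula forces `Re ∫ f v̄ ≤ 0`.
  have h2 : ∀ i, 0 ≤ (inner ℂ (k i) (g i)).re := fun i => by
    rw [hre]
    refine integral_nonneg_of_ae ?_
    filter_upwards [hk i] with x hx
    rw [hx, Complex.conj_ofReal, Complex.re_mul_ofReal, Pi.zero_apply]
    have := mul_nonneg (deriv_smoothTruncation_nonneg M (u x).re) (mul_self_nonneg (g i x).re)
    linarith
  have h3 : (inner ℂ v f).re ≤ 0 := by
    have := congrArg Complex.re h1
    rw [Complex.add_re, Complex.re_sum, Complex.zero_re] at this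
    linarith [Finset.sum_nonneg fun i (_ : i ∈ Finset.univ) => h2 i]
  have hreL : ∀ v : L2 Ω, MemLp (fun x => (v x).re) 2
      (volume.restrict (Ω : Set (EuclideanSpace ℝ (Fin d)))) := fun v => (Lp.memLp v).re
  have hG := contDiff_smoothTruncation M (n := 1)
  have hbm : MemLp (fun x => smoothTruncation M (u x).re) 2
      (volume.restrict (Ω : Set (EuclideanSpace ℝ (Fin d)))) :=
    MemLp.of_bound (hG.continuous.comp_aestronglyMeasurable (hreL u).aestronglyMeasurable) 1
      (Eventually.of_forall fun x => abs_smoothTruncation_le M _)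
  have hint1 : Integrable (fun x => smoothTruncation M (u x).re * ((u x).re - M))
      (volume.restrict (Ω : Set (EuclideanSpace ℝ (Fin d)))) :=
    hbm.integrable_mul ((hreL u).sub (memLp_const M))
  have hint2 : Integrable (fun x => smoothTruncation M (u x).re * (f x).re)
      (volume.restrict (Ω : Set (EuclideanSpace ℝ (Fin d)))) := hbm.integrable_mul (hreL f)
  have h4 : (inner ℂ v f).re =
      ∫ x in (Ω : Set (EuclideanSpace ℝ (Fin d))), smoothTruncation M (u x).re * (f x).re := by
    rw [hre]
    refine integral_congr_ae ?_
    filter_upwards [hv] with x hx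
    rw [hx, Complex.conj_ofReal, Complex.re_mul_ofReal, mul_comm]
  -- The hypothesis `Re u - M ≤ h Re f` is multiplied by `G(Re u) ≥ 0`. The resulting left-hand
  -- integrand is nonnegative with integral at most `0`, hence vanishes a.e.
  have h5 : ∫ x in (Ω : Set (EuclideanSpace ℝ (Fin d))),
      smoothTruncation M (u x).re * ((u x).re - M) ≤ h * (inner ℂ v f).re := by
    rw [h4, ← integral_const_mul]
    refine integral_mono_ae hint1 (hint2.const_mul h) ?_
    filter_upwards [hM] with x hx
    have h6 : 0 ≤ smoothTruncation M (u x).re := Real.smoothTransition.nonneg _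
    nlinarith
  have h6 : ∫ x in (Ω : Set (EuclideanSpace ℝ (Fin d))),
      smoothTruncation M (u x).re * ((u x).re - M) = 0 :=
    le_antisymm (h5.trans (mul_nonpos_of_nonneg_of_nonpos hh.le h3))
      (integral_nonneg fun x => smoothTruncation_mul_sub_nonneg M _)
  have h7 := (integral_eq_zero_iff_of_nonneg
    (fun x => smoothTruncation_mul_sub_nonneg M _) hint1).1 h6
  filter_upwards [h7] with x hx
  exact le_of_smoothTruncation_mul_sub_eq_zero hx

end Invariance

/-! ### Half-plane constraints and the submarkovian property -/

section HalfPlane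

variable {X : Type*} [MeasurableSpace X] {μ : Measure X}

/-- The `L²`-functions with values in the half-plane `{z | Re (c z) ≤ M}`. -/
def halfPlaneSet (μ : Measure X) (c : ℂ) (M : ℝ) : Set (Lp ℂ 2 μ) :=
  {f | ∀ᵐ x ∂μ, (c * f x).re ≤ M}

/-- An `L²`-convergent sequence has a subsequence converging a.e., and closed half-planes pass to
pointwise limits. -/
theorem isClosed_halfPlaneSet (c : ℂ) (M : ℝ) : IsClosed (halfPlaneSet μ c M) := by
  refine IsSeqClosed.isClosed fun f f₀ hf hlim => ?_
  obtain ⟨ns, -, hns⟩ := (tendstoInMeasure_of_tendsto_Lp hlim).exists_seq_tendsto_ae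
  have hall : ∀ᵐ x ∂μ, ∀ n, (c * f n x).re ≤ M := ae_all_iff.2 hf
  filter_upwards [hns, hall] with x hx hfx
  have hcont : Continuous fun z : ℂ => (c * z).re := by fun_prop
  exact le_of_tendsto ((hcont.tendsto _).comp hx) (Eventually.of_forall fun n => hfx _)

theorem isNonneg_iff_mem_halfPlaneSet (f : Lp ℂ 2 μ) :
    IsNonneg f ↔ f ∈ halfPlaneSet μ (-1) 0 ∧ f ∈ halfPlaneSet μ Complex.I 0 ∧
      f ∈ halfPlaneSet μ (-Complex.I) 0 := by
  simp only [IsNonneg, halfPlaneSet, Set.mem_ofPred_eq, ← eventually_and]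
  refine eventually_congr (Eventually.of_forall fun x => ?_)
  simp only [neg_mul, one_mul, Complex.neg_re, Complex.I_mul_re, neg_neg]
  constructor
  · rintro ⟨h1, h2⟩
    exact ⟨by linarith, by linarith, by linarith⟩
  · rintro ⟨h1, h2, h3⟩
    exact ⟨by linarith, by linarith⟩

/-- A disc is an intersection of half-planes; the decisive direction is `c = conj z`, reached by
continuity. -/
theorem norm_le_of_forall_dense_re_mul_le {z : ℂ} {K : ℝ} {s : Set ℂ} (hs : Dense s)
    (h : ∀ c ∈ s, (c * z).re ≤ K * ‖c‖) : ‖z‖ ≤ K := by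
  have hc : IsClosed {c : ℂ | (c * z).re ≤ K * ‖c‖} := isClosed_le (by fun_prop) (by fun_prop)
  have h1 : ∀ c : ℂ, (c * z).re ≤ K * ‖c‖ := fun c => closure_minimal h hc (hs c)
  have h2 := h1 (conj z)
  rw [← Complex.normSq_eq_conj_mul_self, Complex.ofReal_re, Complex.normSq_eq_norm_sq,
    Complex.norm_conj] at h2
  rcases (norm_nonneg z).eq_or_lt with h0 | h0
  · have := h1 1
    rw [← h0]
    have hz : z = 0 := norm_eq_zero.1 h0.symm
    simpa [hz] using this
  · nlinarith

/-- A family of operators that leaves all sets of functions with values in a half-plane containing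
the origin invariant is submarkovian. -/
theorem isSubmarkovian_of_halfPlaneSet {S : ℝ≥0 → Lp ℂ 2 μ →L[ℂ] Lp ℂ 2 μ}
    (hS : ∀ t, 0 < t → ∀ (c : ℂ) (M : ℝ), 0 ≤ M → ∀ f ∈ halfPlaneSet μ c M,
      S t f ∈ halfPlaneSet μ c M) :
    IsSubmarkovian S := by
  constructor
  · intro t ht f hf
    rw [isNonneg_iff_mem_halfPlaneSet] at hf ⊢
    exact ⟨hS t ht _ _ le_rfl f hf.1, hS t ht _ _ le_rfl f hf.2.1, hS t ht _ _ le_rfl f hf.2.2⟩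
  · intro t ht f hf
    set K := (eLpNorm f ∞ μ).toReal with hK
    have hfK : ∀ᵐ x ∂μ, ‖f x‖ ≤ K := by
      filter_upwards [ae_le_eLpNormEssSup (f := f) (μ := μ)] with x hx
      rw [← eLpNorm_exponent_top] at hx
      rw [hK, ← toReal_enorm]
      exact ENNReal.toReal_mono hf.eLpNorm_ne_top hx
    have hc : ∀ c : ℂ, S t f ∈ halfPlaneSet μ c (K * ‖c‖) := fun c => by
      refine hS t ht c _ (by positivity) f ?_
      filter_upwards [hfK] with x hx
      calc (c * f x).re ≤ ‖c * f x‖ := Complex.re_le_norm _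
        _ = ‖f x‖ * ‖c‖ := by rw [norm_mul, mul_comm]
        _ ≤ K * ‖c‖ := by gcongr
    -- Only countably many directions are used, so that the exceptional null sets have a null union.
    have hall : ∀ᵐ x ∂μ, ∀ n, (denseSeq ℂ n * S t f x).re ≤ K * ‖denseSeq ℂ n‖ :=
      ae_all_iff.2 fun n => hc _
    have hbound : ∀ᵐ x ∂μ, ‖S t f x‖ ≤ K := by
      filter_upwards [hall] with x hx
      refine norm_le_of_forall_dense_re_mul_le (denseRange_denseSeq ℂ) ?_
      rintro _ ⟨n, rfl⟩
      exact hx n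
    calc eLpNorm (S t f) ∞ μ ≤ ENNReal.ofReal K := by
          rw [eLpNorm_exponent_top]
          exact eLpNormEssSup_le_of_ae_bound hbound
      _ = eLpNorm f ∞ μ := ENNReal.ofReal_toReal hf.eLpNorm_ne_top

end HalfPlane

/-! ### Invariance under the resolvents and conclusion -/

section Main

variable {d : ℕ} {Ω : Opens (EuclideanSpace ℝ (Fin d))}

/-- By complex linearity `c u` solves the resolvent equation with datum multiplied by `c`, which
reduces the half-plane to a bound on the real part. -/
theorem neumannResolvent_mem_halfPlaneSet
    (hΩ : Bornology.IsBounded (Ω : Set (EuclideanSpace ℝ (Fin d)))) (c : ℂ) (M h : ℝ) (hh : 0 < h)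
    (w : L2 Ω)
    (hw : neumannResolvent Ω w + (h : ℂ) • (w - neumannResolvent Ω w) ∈
      halfPlaneSet (volume.restrict (Ω : Set (EuclideanSpace ℝ (Fin d)))) c M) :
    neumannResolvent Ω w ∈
      halfPlaneSet (volume.restrict (Ω : Set (EuclideanSpace ℝ (Fin d)))) c M := by
  set u := neumannResolvent Ω w with hu
  have huf : (c • u, c • (u - w)) ∈ neumannLaplacian Ω := by
    rw [mem_neumannLaplacian_iff, ← smul_sub, sub_sub_cancel, map_smul]
  have h1 := re_le_of_re_sub_smul_le hΩ huf hh (M := M) ?_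
  · filter_upwards [h1, Lp.coeFn_smul c u] with x hx hcu
    rwa [hcu] at hx
  · filter_upwards [hw, Lp.coeFn_smul c u, Lp.coeFn_smul c (u - w), Lp.coeFn_sub u w,
      Lp.coeFn_add u ((h : ℂ) • (w - u)), Lp.coeFn_smul (h : ℂ) (w - u), Lp.coeFn_sub w u]
      with x hx h2 h3 h4 h5 h6 h7
    rw [h2, h3, Pi.smul_apply, Pi.smul_apply, h4, Pi.sub_apply]
    rw [h5, Pi.add_apply, h6, Pi.smul_apply, h7, Pi.sub_apply] at hx
    refine le_trans (le_of_eq ?_) hx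
    simp only [smul_eq_mul, Complex.mul_re, Complex.add_re, Complex.add_im, Complex.sub_re,
      Complex.sub_im, Complex.mul_im, Complex.ofReal_re, Complex.ofReal_im]
    ring

theorem generatesSubmarkovianC0Semigroup_neumannLaplacian
    (hΩ : Bornology.IsBounded (Ω : Set (EuclideanSpace ℝ (Fin d)))) :
    GeneratesSubmarkovianC0Semigroup (neumannLaplacian Ω) := by
  have h0 := neumannResolvent_nonneg Ω
  have h1 := norm_neumannResolvent_le Ω
  have hinj := injective_neumannResolvent (Ω := Ω)
  refine ⟨cfcSemigroup (neumannResolvent Ω), isC0Semigroup_cfcSemigroup h0 h1 hinj,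
    isGenerator_cfcSemigroup h0 h1 hinj mem_neumannLaplacian_iff,
    isSubmarkovian_of_halfPlaneSet fun t ht c M _ f hf => ?_⟩
  exact cfcSemigroup_mem_of_isClosed h0 h1 hinj (isClosed_halfPlaneSet c M)
    (neumannResolvent_mem_halfPlaneSet hΩ c M) ht hf

end Main

end NeumannLap

theorem proposition6p1 (d : ℕ) (Ω : Opens (EuclideanSpace ℝ (Fin d)))
    (hΩ : Bornology.IsBounded (Ω : Set (EuclideanSpace ℝ (Fin d)))) :
    NeumannLap.GeneratesSubmarkovianC0Semigroup (NeumannLap.neumannLaplacian Ω) ∧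
    (NeumannLap.H1 Ω ⊆ closure (NeumannLap.H1Cont Ω) →
      NeumannLap.GeneratesSubmarkovianC0Semigroup (NeumannLap.neumannLaplacianCont Ω)) := by
  refine ⟨NeumannLap.generatesSubmarkovianC0Semigroup_neumannLaplacian hΩ, fun h => ?_⟩
  rw [NeumannLap.neumannLaplacianCont_eq h]
  exact NeumannLap.generatesSubmarkovianC0Semigroup_neumannLaplacian hΩ
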